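/- Let $0<\alpha\le\beta$, $\gamma$ and $C_I$ be real constants. There are constants $C,c>0$, depending only on $\alpha,\beta,\gamma,C_I$, such that the following holds. Let $\Omega\subset\mathbb R^2$ be a polygonal domain (a connected open set that is the interior of a finite union of triangles), and let $\Gamma$ be a smooth simple curve in $\Omega$ or, more generally, a finite union of smooth simple curves (arcs or loops, whose endpoints may lie on $\partial\Omega$), any two of which meet in finitely many points. Let $V$ be the space of all $v\in H^1_0(\Omega)$ whose trace on $\Gamma$ is continuous and belongs to $H^1$ of each of the curves; $\nabla_\tau v$ denotes the tangential gradient of the trace, $(\cdot,\cdot)_\omega$ and $\|\cdot\|_\omega$ the $L^2$ inner product and norm on a subset $\omega$ of $\Omega$ or of $\Gamma$. Let $A$ on $\Omega$ and $A_\Gamma$ on $\Gamma$ be measurable with $\alpha\le A\le\beta$ and $\alpha\le A_\Gamma\le\beta$ almost everywhere, and set $$a(u,w)=(A\nabla u,\nabla w)_\Omega+(A_\Gamma\nabla_\tau u,\nabla_\tau w)_\Gamma .$$ Let $\mathcal T_H$ be a finite conforming triangulation of $\overline\Omega$ into closed triangles of diameter at most $H$, $H>0$, such that $H/d_T\le\gamma$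 and $d_{T'}/d_T\le\gamma$ for all $T,T'\in\mathcal T_H$, where $d_T$ is the diameter of the inscribed circle of $T$. Let $V_H\subset V$ be the space of continuous functions on $\overline\Omega$ that are affine on every $T\in\mathcal T_H$ and vanish on $\partial\Omega$. For a set $\omega$ let $U(\omega)=\bigcup\{T\in\mathcal T_H: T\cap\omega\ne\emptyset\}$, $U^0(\omega)=\omega$, $U^{k}(\omega)=U(U^{k-1}(\omega))$, and let $U^k_c(T)=\overline{\Omega\setminus U^k(T)}$. Put $\Gamma_T=\Gamma\cap T$ and $U_\Gamma(T)=\Gamma\cap U(T)$. Let $\mathcal I_H:V\to V_H$ be a linear operator with $\mathcal I_H\mathcal I_H=\mathcal I_H$ such that, for all $v\in V$ and $T\in\mathcal T_H$, $$\|v-\mathcal I_Hv\|_T+\|v-\mathcal I_Hv\|_{\Gamma_T}\le C_I H\big(\|\nabla v\|_{U(T)}+\|\nabla_\tau v\|_{U_\Gamma(T)}\big),$$ $$\|\nabla\mathcal I_Hv\|_T+\|\nabla_\tau\mathcal I_Hv\|_{\Gamma_T}\le C_I\big(\|\nabla v\|_{U(T)}+\|\nabla_\tau v\|_{U_\Gamma(T)}\big),$$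 and let $V_{\mathrm f}=\{v\in V:\mathcal I_Hv=0\}$. Let $T\in\mathcal T_H$ and $v\in V_H$, and let $\phi_T\in V_{\mathrm f}$ be the corrector, that is, the solution of $$a(\phi_T,w)=\int_TA\nabla v\cdot\nabla w+\int_{\Gamma_T}A_\Gamma\nabla_\tau v\cdot\nabla_\tau w\qquad\text{for all }w\in V_{\mathrm f}.$$ Then, for every integer $k\ge5$, $$\|\nabla\phi_T\|_{U^k_c(T)}+\|\nabla_\tau\phi_T\|_{\Gamma\cap U^k_c(T)}\le C\,e^{-ck}\big(\|\nabla v\|_T+\|\nabla_\tau v\|_{\Gamma_T}\big).$$ -/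

import Mathlib

open MeasureTheory Set Filter Topology
open scoped ContDiff

namespace FracturedLOD

/-- The Euclidean plane. -/
abbrev Plane : Type := EuclideanSpace ℝ (Fin 2)

/-! ### Domain, interface, triangulation -/

/-- A polygonal domain: a (nonempty) connected open set which is the interior of a finite union of
closed nondegenerate triangles. -/
def IsPolygonalDomain (Ω : Set Plane) : Prop :=
  IsConnected Ω ∧ ∃ F : Set (Finset Plane), F.Finite ∧
    (∀ s ∈ F, s.card = 3 ∧ AffineIndependent ℝ ((↑) : s → Plane)) ∧
    Ω = interior (⋃ s ∈ F, convexHull ℝ (s : Set Plane))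

/-- An interface (fracture) in `Ω`: finitely many smooth simple curves, parametrized by arc length,
each one an arc or a loop that runs in `Ω` except possibly for its endpoints. Two different curves
meet in at most finitely many points. One smooth curve is the case `n = 1`; several curves give
intersecting and immersed interfaces. -/
structure Interface (Ω : Set Plane) where
  /-- number of curves -/
  n : ℕ
  /-- lengths of the curves -/
  len : Fin n → ℝ
  /-- arc length parametrizations, considered on `[0, len i]` -/
  curve : Fin n → ℝ → Plane
  len_pos : ∀ i, 0 < len i
  smooth : ∀ i, ContDiffOn ℝ ∞ (curve i) (Icc 0 (len i))
  unit_speed : ∀ i, ∀ t ∈ Ioo 0 (len i), ‖deriv (curve i) t‖ = 1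
  injOn_left : ∀ i, InjOn (curve i) (Ico 0 (len i))
  injOn_right : ∀ i, InjOn (curve i) (Ioc 0 (len i))
  mem_domain : ∀ i, ∀ t ∈ Ioo 0 (len i), curve i t ∈ Ω
  finite_inter : ∀ i j, i ≠ j →
    (curve i '' Icc 0 (len i) ∩ curve j '' Icc 0 (len j)).Finite

/-- The point set `Γ`. -/
def Interface.carrier {Ω : Set Plane} (Γ : Interface Ω) : Set Plane :=
  ⋃ i, Γ.curve i '' Icc 0 (Γ.len i)

/-- The parameters of the points of the `i`-th curve that lie in `S`. -/
def Interface.param {Ω : Set Plane} (Γ : Interface Ω) (i : Fin Γ.n) (S : Set Plane) : Set ℝ :=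
  Icc 0 (Γ.len i) ∩ Γ.curve i ⁻¹' S

/-- `K` is a conforming triangulation of the closure of `Ω`, with finitely many triangles. The
elements are the facets (maximal faces) of `K`. -/
def IsTriangulation (K : Geometry.SimplicialComplex ℝ Plane) (Ω : Set Plane) : Prop :=
  K.faces.Finite ∧ (∀ T ∈ K.facets, T.card = 3) ∧ K.space = closure Ω

/-- The closed triangle with vertex set `T`. -/
def cell (T : Finset Plane) : Set Plane := convexHull ℝ (T : Set Plane)

/-- The diameter of the inscribed circle of a triangle, the largest disc contained in it. -/
noncomputable def inscribedDiam (T : Finset Plane) : ℝ :=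
  2 * sSup {r : ℝ | 0 ≤ r ∧ ∃ x, Metric.closedBall x r ⊆ cell T}

/-- `H` is a mesh size parameter of `K`, and `K` is shape regular and quasi-uniform with
constant `γ`. -/
def MeshRegular (K : Geometry.SimplicialComplex ℝ Plane) (H γ : ℝ) : Prop :=
  0 < H ∧ (∀ T ∈ K.facets, Metric.diam (cell T) ≤ H) ∧
    (∀ T ∈ K.facets, H / inscribedDiam T ≤ γ) ∧
    ∀ T ∈ K.facets, ∀ T' ∈ K.facets, inscribedDiam T' / inscribedDiam T ≤ γ

/-- The element neighbour operator `U`: the union of all elements that meet `S`. -/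
def nbhd (K : Geometry.SimplicialComplex ℝ Plane) (S : Set Plane) : Set Plane :=
  ⋃ T ∈ {T ∈ K.facets | (cell T ∩ S).Nonempty}, cell T

/-- The `k`-layer patch `U^k(T)`, with `U^0(T) = T`. -/
def patch (K : Geometry.SimplicialComplex ℝ Plane) (k : ℕ) (T : Finset Plane) : Set Plane :=
  (nbhd K)^[k] (cell T)

/-- `U^k_c(T)`, the closure of the complement of the patch in `Ω`. -/
def patchCompl (Ω : Set Plane) (K : Geometry.SimplicialComplex ℝ Plane) (k : ℕ)
    (T : Finset Plane) : Set Plane :=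
  closure (Ω \ patch K k T)

/-! ### The space `V` -/

section Space

variable {Ω : Set Plane} (Γ : Interface Ω)

/-- Data `(u, G, g, d)` of a function in the bulk, its gradient, its trace on the interface, and
the derivative of the trace with respect to arc length. -/
abbrev Data : Type :=
  Lp ℝ 2 (volume.restrict Ω) × Lp Plane 2 (volume.restrict Ω) ×
    ((i : Fin Γ.n) → Lp ℝ 2 (volume.restrict (Icc 0 (Γ.len i)))) ×
    ((i : Fin Γ.n) → Lp ℝ 2 (volume.restrict (Icc 0 (Γ.len i))))

/-- `u ∈ H¹₀(Ω)` with weak gradient `G` and with trace `g` on the interface: some sequence in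
`C_c^∞(Ω)` converges to `u` in `H¹`, and its restrictions to the interface converge to `g` in `L²`.
(By the trace theorem, the second convergence follows from the first, for exactly one `g`.) -/
def IsH10WithTrace (v : Data Γ) : Prop :=
  ∃ φ : ℕ → Plane → ℝ,
    (∀ m, ContDiff ℝ ∞ (φ m) ∧ HasCompactSupport (φ m) ∧ tsupport (φ m) ⊆ Ω) ∧
    Tendsto (fun m => eLpNorm (fun x => φ m x - v.1 x) 2 (volume.restrict Ω)) atTop (𝓝 0) ∧
    Tendsto (fun m => eLpNorm (fun x => gradient (φ m) x - v.2.1 x) 2 (volume.restrict Ω))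
      atTop (𝓝 0) ∧
    ∀ i, Tendsto (fun m => eLpNorm (fun t => φ m (Γ.curve i t) - v.2.2.1 i t) 2
      (volume.restrict (Icc 0 (Γ.len i)))) atTop (𝓝 0)

/-- The trace `g` has a representative that is continuous on `Γ` and, along every curve, absolutely
continuous in arc length with derivative `d ∈ L²`. On one curve, this is `g ∈ H¹(Γ)` with
tangential derivative `d`; for several curves, `g` is in `H¹` of each curve and is continuous
on `Γ`. -/
def IsH1Interface (v : Data Γ) : Prop :=
  ∃ g : Plane → ℝ, ContinuousOn g Γ.carrier ∧ ∀ i,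
    (∀ᵐ t ∂volume.restrict (Icc 0 (Γ.len i)), v.2.2.1 i t = g (Γ.curve i t)) ∧
    ∀ t ∈ Icc 0 (Γ.len i), g (Γ.curve i t) = g (Γ.curve i 0) + ∫ s in (0)..t, v.2.2.2 i s

theorem tendsto_add_aux {α F : Type*} [MeasurableSpace α] [NormedAddCommGroup F] {μ : Measure α}
    {f g h : ℕ → α → F} (hf : ∀ m, AEStronglyMeasurable (f m) μ)
    (hg : ∀ m, AEStronglyMeasurable (g m) μ)
    (h1 : Tendsto (fun m => eLpNorm (f m) 2 μ) atTop (𝓝 0))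
    (h2 : Tendsto (fun m => eLpNorm (g m) 2 μ) atTop (𝓝 0))
    (hh : ∀ m, h m =ᵐ[μ] f m + g m) :
    Tendsto (fun m => eLpNorm (h m) 2 μ) atTop (𝓝 0) := by
  refine tendsto_of_tendsto_of_tendsto_of_le_of_le tendsto_const_nhds
    (by simpa using h1.add h2) (fun _ => zero_le) (fun m => ?_)
  simp only
  rw [eLpNorm_congr_ae (hh m)]
  exact eLpNorm_add_le (hf m) (hg m) (by norm_num)

theorem tendsto_smul_aux {α F : Type*} [MeasurableSpace α] [NormedAddCommGroup F]
    [NormedSpace ℝ F] {μ : Measure α} {f h : ℕ → α → F} (c : ℝ)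
    (h1 : Tendsto (fun m => eLpNorm (f m) 2 μ) atTop (𝓝 0))
    (hh : ∀ m, h m =ᵐ[μ] c • f m) :
    Tendsto (fun m => eLpNorm (h m) 2 μ) atTop (𝓝 0) := by
  have : ∀ m, eLpNorm (h m) 2 μ = ‖c‖ₑ * eLpNorm (f m) 2 μ := fun m => by
    rw [eLpNorm_congr_ae (hh m), eLpNorm_const_smul]
  simp only [this]
  simpa using ENNReal.Tendsto.const_mul h1 (Or.inr (by simp))

theorem continuous_gradient {f : Plane → ℝ} (hf : ContDiff ℝ ∞ f) : Continuous (gradient f) :=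
  (InnerProductSpace.toDual ℝ Plane).symm.continuous.comp (hf.continuous_fderiv (by simp))

theorem curve_continuousOn (i : Fin Γ.n) : ContinuousOn (Γ.curve i) (Icc 0 (Γ.len i)) :=
  (Γ.smooth i).continuousOn

theorem lp_intervalIntegrable {L : ℝ} (d : Lp ℝ 2 (volume.restrict (Icc 0 L))) {t : ℝ}
    (ht : t ∈ Icc 0 L) : IntervalIntegrable d volume 0 t := by
  have h : IntegrableOn d (Icc 0 L) := (Lp.memLp d).integrable (by norm_num)
  rw [intervalIntegrable_iff_integrableOn_Ioc_of_le ht.1]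
  exact h.mono_set fun s hs => ⟨hs.1.le, hs.2.trans ht.2⟩

theorem integral_congr_lp {L : ℝ} {d e : ℝ → ℝ} (h : d =ᵐ[volume.restrict (Icc 0 L)] e) {t : ℝ}
    (ht : t ∈ Icc 0 L) : ∫ s in (0)..t, d s = ∫ s in (0)..t, e s := by
  rw [intervalIntegral.integral_of_le ht.1, intervalIntegral.integral_of_le ht.1]
  refine integral_congr_ae (ae_mono (Measure.restrict_mono ?_ le_rfl) h)
  exact fun s hs => ⟨hs.1.le, hs.2.trans ht.2⟩

variable {Γ}

theorem IsH10WithTrace.add {v w : Data Γ} (hv : IsH10WithTrace Γ v) (hw : IsH10WithTrace Γ w) :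
    IsH10WithTrace Γ (v + w) := by
  obtain ⟨φ, hφ, h1, h2, h3⟩ := hv
  obtain ⟨ψ, hψ, k1, k2, k3⟩ := hw
  refine ⟨fun m => φ m + ψ m, fun m => ⟨(hφ m).1.add (hψ m).1, (hφ m).2.1.add (hψ m).2.1, ?_⟩,
    ?_, ?_, fun i => ?_⟩
  · exact (tsupport_add _ _).trans (union_subset (hφ m).2.2 (hψ m).2.2)
  · refine tendsto_add_aux (fun m => ?_) (fun m => ?_) h1 k1 (fun m => ?_)
    · exact (hφ m).1.continuous.aestronglyMeasurable.sub (Lp.aestronglyMeasurable _)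
    · exact (hψ m).1.continuous.aestronglyMeasurable.sub (Lp.aestronglyMeasurable _)
    · filter_upwards [Lp.coeFn_add v.1 w.1] with x hx
      simp only [Prod.fst_add, Pi.add_apply, hx]; ring
  · refine tendsto_add_aux (fun m => ?_) (fun m => ?_) h2 k2 (fun m => ?_)
    · exact (continuous_gradient (hφ m).1).aestronglyMeasurable.sub (Lp.aestronglyMeasurable _)
    · exact (continuous_gradient (hψ m).1).aestronglyMeasurable.sub (Lp.aestronglyMeasurable _)
    · filter_upwards [Lp.coeFn_add v.2.1 w.2.1] with x hx
      have : gradient (φ m + ψ m) x = gradient (φ m) x + gradient (ψ m) x := by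
        simp only [gradient]
        rw [fderiv_add ((hφ m).1.differentiable (by simp) x) ((hψ m).1.differentiable (by simp) x),
          map_add]
      simp only [Prod.fst_add, Prod.snd_add, Pi.add_apply, hx, this]; abel
  · refine tendsto_add_aux (fun m => ?_) (fun m => ?_) (h3 i) (k3 i) (fun m => ?_)
    · exact (((hφ m).1.continuous.comp_continuousOn (curve_continuousOn Γ i)).aestronglyMeasurable
        measurableSet_Icc).sub (Lp.aestronglyMeasurable _)
    · exact (((hψ m).1.continuous.comp_continuousOn (curve_continuousOn Γ i)).aestronglyMeasurable
        measurableSet_Icc).sub (Lp.aestronglyMeasurable _)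
    · filter_upwards [Lp.coeFn_add (v.2.2.1 i) (w.2.2.1 i)] with x hx
      simp only [Prod.fst_add, Prod.snd_add, Pi.add_apply, hx]; ring

theorem IsH10WithTrace.smul {v : Data Γ} (c : ℝ) (hv : IsH10WithTrace Γ v) :
    IsH10WithTrace Γ (c • v) := by
  obtain ⟨φ, hφ, h1, h2, h3⟩ := hv
  refine ⟨fun m => c • φ m, fun m => ⟨(hφ m).1.const_smul c, (hφ m).2.1.smul_left (f := fun _ => c),
    ?_⟩, ?_, ?_, fun i => ?_⟩
  · exact (tsupport_smul_subset_right (fun _ => c) (φ m)).trans (hφ m).2.2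
  · refine tendsto_smul_aux c h1 (fun m => ?_)
    filter_upwards [Lp.coeFn_smul c v.1] with x hx
    simp only [Prod.smul_fst, Pi.smul_apply, hx, smul_eq_mul]; ring
  · refine tendsto_smul_aux c h2 (fun m => ?_)
    filter_upwards [Lp.coeFn_smul c v.2.1] with x hx
    have : gradient (c • φ m) x = c • gradient (φ m) x := by
      simp only [gradient]
      rw [fderiv_const_smul ((hφ m).1.differentiable (by simp) x)]
      simp
    simp only [Prod.smul_fst, Prod.smul_snd, Pi.smul_apply, hx, this, smul_sub]
  · refine tendsto_smul_aux c (h3 i) (fun m => ?_)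
    filter_upwards [Lp.coeFn_smul c (v.2.2.1 i)] with x hx
    simp only [Prod.smul_fst, Prod.smul_snd, Pi.smul_apply, hx, smul_eq_mul]; ring

theorem IsH1Interface.add {v w : Data Γ} (hv : IsH1Interface Γ v) (hw : IsH1Interface Γ w) :
    IsH1Interface Γ (v + w) := by
  obtain ⟨g, hg, h⟩ := hv
  obtain ⟨e, he, k⟩ := hw
  refine ⟨g + e, hg.add he, fun i => ⟨?_, fun t ht => ?_⟩⟩
  · filter_upwards [Lp.coeFn_add (v.2.2.1 i) (w.2.2.1 i), (h i).1, (k i).1] with x hx h1 h2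
    simp only [Prod.fst_add, Prod.snd_add, Pi.add_apply, hx, h1, h2]
  · have := integral_congr_lp (Lp.coeFn_add (v.2.2.2 i) (w.2.2.2 i)) ht
    simp only [Prod.snd_add, Pi.add_apply] at this ⊢
    rw [this, intervalIntegral.integral_add (lp_intervalIntegrable _ ht)
      (lp_intervalIntegrable _ ht), (h i).2 t ht, (k i).2 t ht]
    ring

theorem IsH1Interface.smul {v : Data Γ} (c : ℝ) (hv : IsH1Interface Γ v) :
    IsH1Interface Γ (c • v) := by
  obtain ⟨g, hg, h⟩ := hv
  refine ⟨c • g, hg.const_smul c, fun i => ⟨?_, fun t ht => ?_⟩⟩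
  · filter_upwards [Lp.coeFn_smul c (v.2.2.1 i), (h i).1] with x hx h1
    simp only [Prod.smul_fst, Prod.smul_snd, Pi.smul_apply, hx, h1]
  · have := integral_congr_lp (Lp.coeFn_smul c (v.2.2.2 i)) ht
    simp only [Prod.smul_snd, Pi.smul_apply, smul_eq_mul] at this ⊢
    rw [this, intervalIntegral.integral_const_mul, (h i).2 t ht]
    ring

variable (Γ)

/-- The space `V = H¹₀(Ω) ∩ H¹(Γ)`. The bulk function determines the other three components: its
weak gradient, its trace on `Γ`, and the tangential derivative of the trace. -/
noncomputable def energySpace : Submodule ℝ (Data Γ) where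
  carrier := {v | IsH10WithTrace Γ v ∧ IsH1Interface Γ v}
  add_mem' hv hw := ⟨hv.1.add hw.1, hv.2.add hw.2⟩
  zero_mem' := by
    refine ⟨⟨fun _ _ => 0, fun _ => ⟨contDiff_const, .zero, by simp⟩, ?_, ?_, fun i => ?_⟩,
      ⟨0, continuousOn_const, fun i => ⟨?_, fun t ht => ?_⟩⟩⟩
    · refine tendsto_const_nhds.congr fun m => (eLpNorm_eq_zero_of_ae_zero ?_).symm
      filter_upwards [Lp.coeFn_zero ℝ 2 (volume.restrict Ω)] with x hx
      simp
      exact hx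
    · refine tendsto_const_nhds.congr fun m => (eLpNorm_eq_zero_of_ae_zero ?_).symm
      filter_upwards [Lp.coeFn_zero Plane 2 (volume.restrict Ω)] with x hx
      simp [gradient]
      exact hx
    · refine tendsto_const_nhds.congr fun m => (eLpNorm_eq_zero_of_ae_zero ?_).symm
      filter_upwards [Lp.coeFn_zero ℝ 2 (volume.restrict (Icc 0 (Γ.len i)))] with x hx
      simp
      exact hx
    · filter_upwards [Lp.coeFn_zero ℝ 2 (volume.restrict (Icc 0 (Γ.len i)))] with x hx
      simp
      exact hx
    · have := integral_congr_lp (Lp.coeFn_zero ℝ 2 (volume.restrict (Icc 0 (Γ.len i)))) ht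
      simp only [Prod.snd_zero, Pi.zero_apply] at this ⊢
      rw [this]; simp
  smul_mem' c _ hv := ⟨hv.1.smul c, hv.2.smul c⟩

variable {Γ}

/-- The bulk function of an element of `V`. -/
noncomputable def bulk (v : energySpace Γ) : Plane → ℝ := v.1.1

/-- The weak gradient `∇v` of an element of `V`. -/
noncomputable def grad (v : energySpace Γ) : Plane → Plane := v.1.2.1

/-- The trace of an element of `V` on the `i`-th curve, as a function of arc length. -/
noncomputable def trace (v : energySpace Γ) (i : Fin Γ.n) : ℝ → ℝ := v.1.2.2.1 i

/-- The tangential gradient `∇_τ v` on the `i`-th curve, that is, the derivative of the trace with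
respect to arc length, as a function of arc length. -/
noncomputable def tgrad (v : energySpace Γ) (i : Fin Γ.n) : ℝ → ℝ := v.1.2.2.2 i

/-- The norm of `L²(Ω ∩ S)`. -/
noncomputable def bulkNorm {F : Type*} [NormedAddCommGroup F] (Ω S : Set Plane) (f : Plane → F) :
    ℝ :=
  √(∫ x in Ω ∩ S, ‖f x‖ ^ 2)

/-- The norm of `L²(Γ ∩ S)`. -/
noncomputable def interfaceNorm (Γ : Interface Ω) (S : Set Plane) (f : Fin Γ.n → ℝ → ℝ) : ℝ :=
  √(∑ i, ∫ t in Γ.param i S, f i t ^ 2)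

/-- `‖v‖_S + ‖v‖_{Γ ∩ S}`. -/
noncomputable def valueNorm (S : Set Plane) (v : energySpace Γ) : ℝ :=
  bulkNorm Ω S (bulk v) + interfaceNorm Γ S (trace v)

/-- `‖∇v‖_S + ‖∇_τ v‖_{Γ ∩ S}`. -/
noncomputable def gradNorm (S : Set Plane) (v : energySpace Γ) : ℝ :=
  bulkNorm Ω S (grad v) + interfaceNorm Γ S (tgrad v)

/-- The bilinear form `(A∇v, ∇w)_S + (A_Γ ∇_τ v, ∇_τ w)_{Γ ∩ S}`: it is `a(v, w)` for the whole
plane `S = univ`, and `a_T(v, w)` for the closed element `S = T`. -/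
noncomputable def form (A AΓ : Plane → ℝ) (S : Set Plane) (v w : energySpace Γ) : ℝ :=
  (∫ x in Ω ∩ S, A x * inner ℝ (grad v x) (grad w x)) +
    ∑ i, ∫ t in Γ.param i S, AΓ (Γ.curve i t) * (tgrad v i t * tgrad w i t)

/-- The permeabilities `A` on `Ω` and `A_Γ` on `Γ` are measurable, with values in `[α, β]` almost
everywhere. -/
def CoefficientBounds (Γ : Interface Ω) (A AΓ : Plane → ℝ) (α β : ℝ) : Prop :=
  AEMeasurable A (volume.restrict Ω) ∧ (∀ᵐ x ∂volume.restrict Ω, α ≤ A x ∧ A x ≤ β) ∧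
    ∀ i, AEMeasurable (fun t => AΓ (Γ.curve i t)) (volume.restrict (Icc 0 (Γ.len i))) ∧
      ∀ᵐ t ∂volume.restrict (Icc 0 (Γ.len i)), α ≤ AΓ (Γ.curve i t) ∧ AΓ (Γ.curve i t) ≤ β

variable (Γ) in
/-- The coarse space `V_H` of continuous functions on the closure of `Ω` that are affine on each
element and vanish on the boundary. -/
noncomputable def coarseSpace (K : Geometry.SimplicialComplex ℝ Plane) :
    Submodule ℝ (energySpace Γ) where
  carrier := {v | ∃ p : Plane → ℝ, ContinuousOn p (closure Ω) ∧
    (∀ T ∈ K.facets, ∃ l : Plane →ᵃ[ℝ] ℝ, EqOn p l (cell T)) ∧ (∀ x ∈ frontier Ω, p x = 0) ∧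
    ∀ᵐ x ∂volume.restrict Ω, bulk v x = p x}
  add_mem' := by
    rintro v w ⟨p, hp, h1, h2, h3⟩ ⟨q, hq, k1, k2, k3⟩
    refine ⟨p + q, hp.add hq, fun T hT => ?_, fun x hx => by simp [h2 x hx, k2 x hx], ?_⟩
    · obtain ⟨l, hl⟩ := h1 T hT
      obtain ⟨m, hm⟩ := k1 T hT
      exact ⟨l + m, fun x hx => by simp [hl hx, hm hx]⟩
    · filter_upwards [Lp.coeFn_add v.1.1 w.1.1, h3, k3] with x hx h k
      simp only [bulk] at h k
      simp only [bulk, Submodule.coe_add, Prod.fst_add, Pi.add_apply, hx, h, k]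
  zero_mem' := by
    refine ⟨0, continuousOn_const, fun T _ => ⟨0, fun x _ => by simp⟩, fun x _ => rfl, ?_⟩
    filter_upwards [Lp.coeFn_zero ℝ 2 (volume.restrict Ω)] with x hx
    simp [bulk]
    exact hx
  smul_mem' := by
    rintro c v ⟨p, hp, h1, h2, h3⟩
    refine ⟨c • p, hp.const_smul c, fun T hT => ?_, fun x hx => by simp [h2 x hx], ?_⟩
    · obtain ⟨l, hl⟩ := h1 T hT
      exact ⟨c • l, fun x hx => by simp [hl hx]⟩
    · filter_upwards [Lp.coeFn_smul c v.1.1, h3] with x hx h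
      simp only [bulk] at h
      simp only [bulk, Submodule.coe_smul, Prod.smul_fst, Pi.smul_apply, hx, h]

/-- The local `L²` error bound and `H¹` stability bound of the interpolation operator. -/
def InterpolationBounds (K : Geometry.SimplicialComplex ℝ Plane) (H C : ℝ)
    (I : energySpace Γ →ₗ[ℝ] coarseSpace Γ K) : Prop :=
  ∀ v : energySpace Γ, ∀ T ∈ K.facets,
    valueNorm (cell T) (v - (I v : energySpace Γ)) ≤ C * H * gradNorm (nbhd K (cell T)) v ∧
    gradNorm (cell T) (I v : energySpace Γ) ≤ C * gradNorm (nbhd K (cell T)) v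

/-- The fine space `V_f`, the kernel of the interpolation operator. -/
noncomputable def fineSpace {K : Geometry.SimplicialComplex ℝ Plane}
    (I : energySpace Γ →ₗ[ℝ] coarseSpace Γ K) : Submodule ℝ (energySpace Γ) :=
  LinearMap.ker I

/-- `φ` is the corrector of the coarse function `v` for the element `T`. -/
def IsCorrector {K : Geometry.SimplicialComplex ℝ Plane} (A AΓ : Plane → ℝ)
    (I : energySpace Γ →ₗ[ℝ] coarseSpace Γ K) (T : Finset Plane) (v : coarseSpace Γ K)
    (φ : energySpace Γ) : Prop :=
  φ ∈ fineSpace I ∧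
    ∀ w ∈ fineSpace I, form A AΓ univ φ w = form A AΓ (cell T) (v : energySpace Γ) w

end Space

end FracturedLOD

/-!
The corrector `φ` of a cell `T` decays exponentially away from `T`, because its energy outside a
patch is controlled by its energy in an annulus of a few layers of cells around that patch.

Let `η` be the continuous piecewise affine function that increases from `0` on the `m`-layer patch
of `T` to `1` outside the next layer (`MeshRegular.exists_cutoff`); by shape regularity its gradient
is at most `2 γ / H`. The product `ψ = η φ` belongs to `V` and satisfies the product rule
(`IsCutoff.exists_mul`): `H¹₀` functions and their traces are limits of test functions, and
multiplying these by mollifications of `η` gives approximants of `ψ`; on the curves the product rule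
for absolutely continuous functions applies. As `I` is a projection, `ψ - I ψ`
lies in its kernel and may be used as a test function. Now three things happen.

* The right-hand side of the equation does not see `ψ - I ψ`, since `ψ` vanishes near `T` and the
  interpolation is quasi-local. Hence `a(φ, ψ) = a(φ, I ψ)`
  (`IsCorrector.form_eq_form_interpolation`).
* The left-hand side controls the energy of `φ` where `η = 1`, up to terms in the layer where `η`
  varies: the energy of `φ` and `H⁻²` times its mass (`IsCutoffProduct.le_form`). As `I φ = 0`, the
  approximation property of `I` is a Poincaré inequality, which absorbs the factor `H⁻²`
  (`InterpolationBounds.massMeasure_le`).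
* The gradient of `I ψ` vanishes except in the layer where `η` varies and the two layers next to it:
  further inside, `ψ = 0` near each cell, and further outside, `ψ = φ` and `I φ = 0`. So `a(φ, I ψ)`
  involves an annulus only.

The local bounds are summed over cells. Their neighbourhoods have finite overlap, because at most
`64 γ²` cells fit near a point, by comparison of areas (`MeshRegular.card_le`). The outcome is the
Caccioppoli inequality `IsCorrector.energyMeasure_outer_le`. Adding a multiple of the energy outside
to both sides ("hole filling") turns it into `E (j + 6) ≤ θ * E j`, with `θ < 1` depending only on
the given constants, for the energy `E j` of `φ` outside `j` layers
(`IsCorrector.energyMeasure_outer_add_six_le`); iteration gives the exponential decay.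

Energies on subsets of the plane are treated as finite measures (`energyMeasure`, `massMeasure`), to
which `Ω` and the curves of `Γ` both contribute, so that additivity, monotonicity and overlap
arguments apply to both at once.
-/

namespace FracturedLOD

variable {K : Geometry.SimplicialComplex ℝ Plane} {Ω : Set Plane} {H γ : ℝ}

/-! ### Cells of a triangulation -/

theorem isCompact_cell (T : Finset Plane) : IsCompact (cell T) :=
  T.finite_toSet.isCompact_convexHull (𝕜 := ℝ)

theorem isClosed_cell (T : Finset Plane) : IsClosed (cell T) := (isCompact_cell T).isClosed

theorem convex_cell (T : Finset Plane) : Convex ℝ (cell T) := convex_convexHull ℝ _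

theorem subset_cell (T : Finset Plane) : (T : Set Plane) ⊆ cell T := subset_convexHull ℝ _

theorem cell_nonempty {T : Finset Plane} (hT : T ∈ K.facets) : (cell T).Nonempty :=
  (K.nonempty_of_mem_faces hT.1).to_set.mono (subset_cell T)

theorem IsTriangulation.finite_facets (hK : IsTriangulation K Ω) : K.facets.Finite :=
  hK.1.subset K.facets_subset

theorem IsTriangulation.exists_facet (hK : IsTriangulation K Ω) {s : Finset Plane}
    (hs : s ∈ K.faces) : ∃ T ∈ K.facets, s ⊆ T := by
  obtain ⟨T, hsT, hT⟩ := hK.1.exists_le_maximal hs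
  exact ⟨T, ⟨hT.prop, fun t ht h => le_antisymm h (hT.2 ht h)⟩, hsT⟩

theorem IsTriangulation.closure_eq (hK : IsTriangulation K Ω) :
    closure Ω = ⋃ T ∈ K.facets, cell T := by
  rw [← hK.2.2]
  ext x
  simp only [K.mem_space_iff, mem_iUnion₂, exists_prop]
  constructor
  · rintro ⟨s, hs, hx⟩
    obtain ⟨T, hT, hsT⟩ := hK.exists_facet hs
    exact ⟨T, hT, convexHull_mono (Finset.coe_subset.2 hsT) hx⟩
  · rintro ⟨T, hT, hx⟩
    exact ⟨T, hT.1, hx⟩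

theorem IsTriangulation.affineSpan_eq_top (hK : IsTriangulation K Ω) {T : Finset Plane}
    (hT : T ∈ K.facets) : affineSpan ℝ (T : Set Plane) = ⊤ := by
  have h := (K.indep hT.1).affineSpan_eq_top_iff_card_eq_finrank_add_one (k := ℝ)
  rw [Subtype.range_coe_subtype] at h
  refine h.2 ?_
  simp [hK.2.1 T hT]

theorem IsTriangulation.interior_cell_nonempty (hK : IsTriangulation K Ω) {T : Finset Plane}
    (hT : T ∈ K.facets) : (interior (cell T)).Nonempty :=
  interior_convexHull_nonempty_iff_affineSpan_eq_top.2 (hK.affineSpan_eq_top hT)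

/-- Two different cells meet in a common face, which is a null set. -/
theorem IsTriangulation.aedisjoint_cell (hK : IsTriangulation K Ω) {S T : Finset Plane}
    (hS : S ∈ K.facets) (hT : T ∈ K.facets) (hST : S ≠ T) :
    AEDisjoint volume (cell S) (cell T) := by
  have hsub : cell S ∩ cell T ⊆ affineSpan ℝ ((S ∩ T : Finset Plane) : Set Plane) := by
    rw [Finset.coe_inter]
    exact (K.inter_subset_convexHull hS.1 hT.1).trans (convexHull_subset_affineSpan _)
  refine measure_mono_null hsub (Measure.addHaar_affineSubspace _ _ fun htop => ?_)
  have hind : AffineIndependent ℝ ((↑) : (S ∩ T : Finset Plane) → Plane) :=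
    (K.indep hS.1).mono (Finset.coe_subset.2 Finset.inter_subset_left)
  have h := hind.affineSpan_eq_top_iff_card_eq_finrank_add_one (k := ℝ)
  rw [Subtype.range_coe_subtype] at h
  have h3 := h.1 htop
  simp only [Fintype.card_coe, finrank_euclideanSpace, Fintype.card_fin] at h3
  refine hST
    ((Finset.eq_of_subset_of_card_le (Finset.inter_subset_left (s₁ := S) (s₂ := T)) ?_).symm.trans
    (Finset.eq_of_subset_of_card_le (Finset.inter_subset_right (s₁ := S) (s₂ := T)) ?_))
  · rw [hK.2.1 S hS]; exact h3.ge
  · rw [hK.2.1 T hT]; exact h3.ge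

/-- Almost every point of `Ω` is interior to some cell. -/
theorem IsTriangulation.ae_mem_interior_cell (hK : IsTriangulation K Ω) :
    ∀ᵐ x ∂volume.restrict Ω, ∀ T ∈ K.facets, x ∈ cell T → x ∈ interior (cell T) := by
  refine ae_restrict_of_ae ((ae_ball_iff hK.finite_facets.countable).2 fun T _ => ?_)
  have h : ∀ᵐ x : Plane, x ∉ frontier (cell T) :=
    measure_eq_zero_iff_ae_notMem.1 ((convex_cell T).addHaar_frontier volume)
  filter_upwards [h] with x hx hxT
  by_contra hi
  exact hx ⟨subset_closure hxT, hi⟩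

/-! ### Shape regularity -/

/-- Every cell contains a disc whose radius is comparable with the mesh size. The supremum defining
the inscribed diameter need not be attained here, at the price of a factor two. -/
theorem MeshRegular.exists_closedBall_subset (hK : IsTriangulation K Ω) (hM : MeshRegular K H γ)
    {T : Finset Plane} (hT : T ∈ K.facets) :
    0 < γ ∧ ∃ x, Metric.closedBall x (H / (4 * γ)) ⊆ cell T := by
  obtain ⟨hH, -, hd, -⟩ := hM
  set S := {r : ℝ | 0 ≤ r ∧ ∃ x, Metric.closedBall x r ⊆ cell T} with hS
  have hbdd : BddAbove S := by
    refine ⟨Metric.diam (cell T), ?_⟩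
    rintro r ⟨hr, x, hx⟩
    obtain ⟨e, he⟩ := exists_norm_eq Plane hr
    have h1 : x + e ∈ cell T := hx (by simp [he])
    have h2 : x ∈ cell T := hx (by simp [hr])
    have := Metric.dist_le_diam_of_mem (isCompact_cell T).isBounded h1 h2
    simpa [he] using this
  obtain ⟨x, hx⟩ := hK.interior_cell_nonempty hT
  obtain ⟨r, hr, hxr⟩ := Metric.nhds_basis_closedBall.mem_iff.1 (mem_interior_iff_mem_nhds.1 hx)
  have hpos : 0 < sSup S := lt_of_lt_of_le hr (le_csSup hbdd (show r ∈ S from ⟨hr.le, x, hxr⟩))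
  have h1 : H / (2 * sSup S) ≤ γ := hd T hT
  have hγ : 0 < γ := lt_of_lt_of_le (by positivity) h1
  refine ⟨hγ, ?_⟩
  rw [div_le_iff₀ (by positivity)] at h1
  have h2 : H / (4 * γ) < sSup S := by
    rw [div_lt_iff₀ (by positivity)]
    nlinarith [mul_pos hγ hpos]
  obtain ⟨s, ⟨-, y, hy⟩, hs⟩ := exists_lt_of_lt_csSup (show S.Nonempty from ⟨r, hr.le, x, hxr⟩) h2
  exact ⟨y, (Metric.closedBall_subset_closedBall hs.le).trans hy⟩

/-- At most `64 γ ^ 2` cells lie within distance `2 H` of a point: they contain disjoint discs of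
radius `H / (4 γ)`, and fit into a disc of radius `2 H`. -/
theorem MeshRegular.card_le (hK : IsTriangulation K Ω) (hM : MeshRegular K H γ)
    (F : Finset (Finset Plane)) (hF : ∀ T ∈ F, T ∈ K.facets) (x : Plane)
    (hx : ∀ T ∈ F, cell T ⊆ Metric.closedBall x (2 * H)) : (F.card : ℝ) ≤ 64 * γ ^ 2 := by
  rcases F.eq_empty_or_nonempty with rfl | ⟨T₀, hT₀⟩
  · simp; positivity
  have hH := hM.1
  have hγ := (hM.exists_closedBall_subset hK (hF T₀ hT₀)).1
  set μ := (volume (Metric.ball (0 : Plane) 1)).toReal with hμ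
  have hμfin : volume (Metric.ball (0 : Plane) 1) ≠ ⊤ := measure_ball_lt_top.ne
  have hμpos : 0 < μ := ENNReal.toReal_pos (Metric.measure_ball_pos _ _ one_pos).ne' hμfin
  have hvol : ∀ (y : Plane) (r : ℝ), 0 ≤ r → volume.real (Metric.closedBall y r) = r ^ 2 * μ := by
    intro y r hr
    rw [Measure.real, Measure.addHaar_closedBall _ _ hr, ENNReal.toReal_mul,
      ENNReal.toReal_ofReal (by positivity)]
    simp [hμ]
  have hsum : ∑ T ∈ F, volume.real (cell T) ≤ volume.real (Metric.closedBall x (2 * H)) := by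
    rw [← measureReal_biUnion_finset₀ (fun S hS T hT h => hK.aedisjoint_cell (hF S hS) (hF T hT) h)
      (fun T _ => (isClosed_cell T).measurableSet.nullMeasurableSet)
      (fun T _ => (isCompact_cell T).measure_lt_top.ne)]
    exact measureReal_mono (iUnion₂_subset hx) measure_closedBall_lt_top.ne
  have hle : ∀ T ∈ F, (H / (4 * γ)) ^ 2 * μ ≤ volume.real (cell T) := by
    intro T hT
    obtain ⟨-, y, hy⟩ := hM.exists_closedBall_subset hK (hF T hT)
    rw [← hvol y _ (by positivity)]
    exact measureReal_mono hy (isCompact_cell T).measure_lt_top.ne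
  have h := (Finset.card_nsmul_le_sum F _ _ hle).trans hsum
  rw [hvol _ _ (by positivity), nsmul_eq_mul, ← mul_assoc] at h
  have h' := le_of_mul_le_mul_right h hμpos
  rw [div_pow, mul_div_assoc', div_le_iff₀ (by positivity)] at h'
  have hH2 : 0 < H ^ 2 := by positivity
  refine le_of_mul_le_mul_right (h'.trans_eq ?_) hH2
  ring

/-! ### Piecewise affine cutoff functions -/

/-- A cutoff function: continuous on the plane, with values in `[0, 1]`, and on every cell equal to
an affine function whose gradient is at most `L`. Outside the triangulated set, only continuity and
the range matter. -/
structure IsCutoff (K : Geometry.SimplicialComplex ℝ Plane) (L : ℝ) (η : Plane → ℝ) : Prop where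
  continuous : Continuous η
  mem_Icc : ∀ x, η x ∈ Icc (0 : ℝ) 1
  affine : ∀ T ∈ K.facets, ∃ l : Plane →ᵃ[ℝ] ℝ, EqOn η l (cell T) ∧ ∀ y, |l.linear y| ≤ L * ‖y‖

theorem abs_linear_le_of_closedBall {l : Plane →ᵃ[ℝ] ℝ} {c : Plane} {r : ℝ} (hr : 0 < r)
    (h : ∀ x ∈ Metric.closedBall c r, l x ∈ Icc (0 : ℝ) 1) (y : Plane) :
    |l.linear y| ≤ 1 / (2 * r) * ‖y‖ := by
  rcases eq_or_ne y 0 with rfl | hy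
  · simp
  have hy' : 0 < ‖y‖ := norm_pos_iff.2 hy
  have hn : ‖(r / ‖y‖) • y‖ = r := by
    rw [norm_smul, Real.norm_of_nonneg (by positivity)]; field_simp
  have key : ∀ z : Plane, ‖z‖ = r → l (z + c) = l.linear z + l c := fun z _ => l.map_vadd c z
  have h1 := h ((r / ‖y‖) • y + c) (by simp [hn])
  have h2 := h (-((r / ‖y‖) • y) + c) (by simp [hn])
  rw [key _ hn, map_smul, smul_eq_mul] at h1
  rw [key _ (by rw [norm_neg, hn]), map_neg, map_smul, smul_eq_mul] at h2
  rw [abs_le]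
  have e : l.linear y = (r / ‖y‖ * l.linear y) * (‖y‖ / r) := by field_simp
  have e2 : 1 / (2 * r) * ‖y‖ = 1 / 2 * (‖y‖ / r) := by field_simp
  have hp : 0 < ‖y‖ / r := by positivity
  rw [e, e2, ← neg_mul]
  constructor <;> refine mul_le_mul_of_nonneg_right ?_ hp.le <;> linarith [h1.1, h1.2, h2.1, h2.2]

/-- An affine function with prescribed values at the vertices of a cell. -/
theorem IsTriangulation.exists_affine (hK : IsTriangulation K Ω) {T : Finset Plane}
    (hT : T ∈ K.facets) (f : Plane → ℝ) : ∃ l : Plane →ᵃ[ℝ] ℝ, ∀ z ∈ T, l z = f z := by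
  let b : AffineBasis T ℝ Plane := ⟨(↑), K.indep hT.1, by
    rw [Subtype.range_coe_subtype]; exact hK.affineSpan_eq_top hT⟩
  refine ⟨∑ i : T, f i • b.coord i, fun z hz => ?_⟩
  have hb : z = b ⟨z, hz⟩ := rfl
  have hsum : ∀ s : Finset T, (∑ i ∈ s, f i • b.coord i) z = ∑ i ∈ s, f i • b.coord i z := by
    intro s
    induction s using Finset.induction_on with
    | empty => simp
    | insert i s hi ih => simp [Finset.sum_insert hi, ih]
  rw [hsum]
  conv_lhs => rw [hb]
  simp [b.coord_apply, Finset.sum_ite_eq']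

/-- Nodal interpolation: for nodal values in `[0, 1]`, the continuous piecewise affine function with
these values at the vertices is a cutoff function. -/
theorem MeshRegular.exists_cutoff (hK : IsTriangulation K Ω) (hM : MeshRegular K H γ)
    (f : Plane → ℝ) (hf : ∀ z, f z ∈ Icc (0 : ℝ) 1) :
    ∃ η, IsCutoff K (2 * γ / H) η ∧
      ∀ T ∈ K.facets, ∀ c, (∀ z ∈ T, f z = c) → ∀ x ∈ cell T, η x = c := by
  choose! l hl using fun T (hT : T ∈ K.facets) => hK.exists_affine hT f
  -- conformity: on the intersection of two cells, both affine functions interpolate the same values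
  have hagree : ∀ S ∈ K.facets, ∀ T ∈ K.facets, ∀ x ∈ cell S ∩ cell T, l S x = l T x := by
    intro S hS T hT x hx
    have hconv : Convex ℝ {x | l S x = l T x} := by
      have : {x | l S x = l T x} = (l S - l T) ⁻¹' {0} := by
        ext x; simp [sub_eq_zero]
      rw [this]
      exact (convex_singleton 0).affine_preimage _
    refine convexHull_min (fun z hz => ?_) hconv (K.inter_subset_convexHull hS.1 hT.1 hx)
    exact (hl S hS z hz.1).trans (hl T hT z hz.2).symm
  have hrange : ∀ T ∈ K.facets, ∀ s : Set ℝ, Convex ℝ s → (∀ z ∈ T, f z ∈ s) →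
      ∀ x ∈ cell T, l T x ∈ s := by
    intro T hT s hs h x hx
    refine convexHull_min (fun z hz => ?_) (hs.affine_preimage (l T)) hx
    simpa [hl T hT z hz] using h z hz
  classical
  let g : Plane → ℝ := fun x => if h : ∃ T ∈ K.facets, x ∈ cell T then l h.choose x else 0
  have hg : ∀ T ∈ K.facets, EqOn g (l T) (cell T) := by
    intro T hT x hx
    have h : ∃ T ∈ K.facets, x ∈ cell T := ⟨T, hT, hx⟩
    simp only [g, dif_pos h]
    exact hagree _ h.choose_spec.1 _ hT _ ⟨h.choose_spec.2, hx⟩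
  have hcont : ContinuousOn g (closure Ω) := by
    rw [hK.closure_eq, biUnion_eq_iUnion]
    have : Finite K.facets := hK.finite_facets
    refine (locallyFinite_of_finite _).continuousOn_iUnion (fun T => isClosed_cell _) fun T => ?_
    exact ((l T).continuous_of_finiteDimensional.continuousOn).congr (hg T T.2)
  obtain ⟨η, hη, hηg⟩ := ContinuousMap.exists_restrict_eq_forall_mem_of_closed
    (⟨(closure Ω).domRestrict g, hcont.domRestrict⟩ : C(closure Ω, ℝ)) (t := Icc 0 1) (fun x => by
      obtain ⟨x, hx⟩ := x
      have hx' := hx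
      rw [hK.closure_eq, mem_iUnion₂] at hx'
      obtain ⟨T, hT, hxT⟩ := hx'
      simp only [ContinuousMap.coe_mk, domRestrict_apply, hg T hT hxT]
      exact hrange T hT _ (convex_Icc 0 1) (fun z _ => hf z) x hxT) ⟨0, by simp⟩ isClosed_closure
  have hηl : ∀ T ∈ K.facets, EqOn η (l T) (cell T) := by
    intro T hT x hx
    have hxΩ : x ∈ closure Ω := by
      rw [hK.closure_eq]; exact mem_biUnion hT hx
    have := DFunLike.congr_fun hηg ⟨x, hxΩ⟩
    exact this.trans (hg T hT hx)
  refine ⟨η, ⟨η.continuous, hη, fun T hT => ⟨l T, hηl T hT, ?_⟩⟩, fun T hT c hc x hx => ?_⟩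
  · obtain ⟨hγ, c, hc⟩ := hM.exists_closedBall_subset hK hT
    have hH := hM.1
    have := abs_linear_le_of_closedBall (l := l T) (c := c) (r := H / (4 * γ)) (by positivity)
      (fun x hx => hrange T hT _ (convex_Icc 0 1) (fun z _ => hf z) x (hc hx))
    have e : 1 / (2 * (H / (4 * γ))) = 2 * γ / H := by field_simp; norm_num
    rwa [e] at this
  · rw [hηl T hT hx]
    exact hrange T hT {c} (convex_singleton c) (fun z hz => hc z hz) x hx

/-! ### Layers of cells -/

/-- The cells of the `k`-layer patch around `T`. -/
def layer (K : Geometry.SimplicialComplex ℝ Plane) (T : Finset Plane) : ℕ → Set (Finset Plane)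
  | 0 => {T}
  | k + 1 => {S ∈ K.facets | (cell S ∩ patch K k T).Nonempty}

/-- The union of the cells that do not belong to the `k`-layer patch. It contains the closed
complement of the patch, and may exceed it by edges. -/
def outer (K : Geometry.SimplicialComplex ℝ Plane) (T : Finset Plane) (k : ℕ) : Set Plane :=
  ⋃ S ∈ K.facets \ layer K T k, cell S

/-- The union of the cells in the `j`-layer patch that are not in the `i`-layer patch. -/
def annulus (K : Geometry.SimplicialComplex ℝ Plane) (T : Finset Plane) (i j : ℕ) : Set Plane :=
  ⋃ S ∈ layer K T j \ layer K T i, cell S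

variable {T : Finset Plane}

theorem patch_succ (k : ℕ) : patch K (k + 1) T = nbhd K (patch K k T) := by
  simp only [patch, Function.iterate_succ_apply']

theorem patch_eq (k : ℕ) : patch K k T = ⋃ S ∈ layer K T k, cell S := by
  cases k with
  | zero => simp [patch, layer]
  | succ k => rw [patch_succ]; rfl

theorem layer_subset_facets (hT : T ∈ K.facets) (k : ℕ) : layer K T k ⊆ K.facets := by
  cases k with
  | zero => simpa [layer] using hT
  | succ k => exact fun S hS => hS.1

theorem cell_subset_patch {S : Finset Plane} {k : ℕ} (hS : S ∈ layer K T k) :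
    cell S ⊆ patch K k T := by
  rw [patch_eq]; exact subset_biUnion_of_mem (u := cell) hS

theorem mem_layer_succ_of_inter {S S' : Finset Plane} {k : ℕ} (hS : S ∈ K.facets)
    (hS' : S' ∈ layer K T k) (h : (cell S ∩ cell S').Nonempty) : S ∈ layer K T (k + 1) :=
  ⟨hS, h.mono (inter_subset_inter_right _ (cell_subset_patch hS'))⟩

theorem layer_mono (hT : T ∈ K.facets) : Monotone (layer K T) := by
  refine monotone_nat_of_le_succ fun k S hS => ?_
  have hSf := layer_subset_facets hT k hS
  exact mem_layer_succ_of_inter hSf hS (by simpa using cell_nonempty hSf)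

theorem mem_nbhd_cell {S : Finset Plane} {x : Plane} :
    x ∈ nbhd K (cell S) ↔ ∃ S' ∈ K.facets, (cell S' ∩ cell S).Nonempty ∧ x ∈ cell S' := by
  simp only [nbhd, mem_iUnion₂, exists_prop, mem_ofPred_eq]
  tauto

theorem outer_anti (hT : T ∈ K.facets) : Antitone (outer K T) := fun _ _ h =>
  biUnion_subset_biUnion_left fun _ hS => ⟨hS.1, fun h' => hS.2 (layer_mono hT h h')⟩

theorem annulus_subset_outer (hT : T ∈ K.facets) (i j : ℕ) : annulus K T i j ⊆ outer K T i :=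
  biUnion_subset_biUnion_left fun _ hS => ⟨layer_subset_facets hT _ hS.1, hS.2⟩

theorem annulus_mono (hT : T ∈ K.facets) {i i' j j' : ℕ} (hi : i ≤ i') (hj : j' ≤ j) :
    annulus K T i' j' ⊆ annulus K T i j :=
  biUnion_subset_biUnion_left fun _ hS =>
    ⟨layer_mono hT hj hS.1, fun h => hS.2 (layer_mono hT hi h)⟩

theorem disjoint_annulus_outer (i j : ℕ) : Disjoint (annulus K T i j) (outer K T (j + 1)) := by
  rw [Set.disjoint_left]
  intro x hx hx'
  simp only [annulus, outer, mem_iUnion₂] at hx hx'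
  obtain ⟨S, hS, hxS⟩ := hx
  obtain ⟨S', hS', hxS'⟩ := hx'
  exact hS'.2 (mem_layer_succ_of_inter hS'.1 hS.1 ⟨x, hxS', hxS⟩)

theorem IsTriangulation.isClosed_biUnion_cell (hK : IsTriangulation K Ω)
    {F : Set (Finset Plane)} (hF : F ⊆ K.facets) : IsClosed (⋃ S ∈ F, cell S) :=
  (hK.finite_facets.subset hF).isClosed_biUnion fun S _ => isClosed_cell S

theorem IsTriangulation.isClosed_nbhd (hK : IsTriangulation K Ω) (s : Set Plane) :
    IsClosed (nbhd K s) := hK.isClosed_biUnion_cell fun _ h => h.1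

theorem IsTriangulation.isClosed_outer (hK : IsTriangulation K Ω) (k : ℕ) :
    IsClosed (outer K T k) := hK.isClosed_biUnion_cell sdiff_subset

theorem IsTriangulation.isClosed_annulus (hK : IsTriangulation K Ω) (hT : T ∈ K.facets)
    (i j : ℕ) : IsClosed (annulus K T i j) :=
  hK.isClosed_biUnion_cell fun _ h => layer_subset_facets hT _ h.1

theorem IsTriangulation.patchCompl_subset_outer (hK : IsTriangulation K Ω) (k : ℕ) :
    patchCompl Ω K k T ⊆ outer K T k := by
  refine closure_minimal (fun x hx => ?_) (hK.isClosed_outer k)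
  have hx1 := subset_closure hx.1
  rw [hK.closure_eq, mem_iUnion₂] at hx1
  obtain ⟨S, hS, hxS⟩ := hx1
  exact mem_biUnion ⟨hS, fun h => hx.2 (cell_subset_patch h hxS)⟩ hxS

/-- The neighbourhood of a cell in an annulus is contained in the annulus that has one more layer
on either side. -/
theorem nbhd_subset_annulus {S : Finset Plane} {i j : ℕ} (hT : T ∈ K.facets)
    (hS : S ∈ layer K T j \ layer K T (i + 1)) :
    nbhd K (cell S) ⊆ annulus K T i (j + 1) := by
  intro x hx
  obtain ⟨S', hS', hne, hxS'⟩ := mem_nbhd_cell.1 hx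
  refine mem_biUnion ⟨mem_layer_succ_of_inter hS' hS.1 hne, fun h => hS.2 ?_⟩ hxS'
  exact mem_layer_succ_of_inter (layer_subset_facets hT _ hS.1) h (by rwa [inter_comm])

/-- The neighbourhoods of the cells overlap at most `64 γ ^ 2` times. -/
theorem MeshRegular.card_filter_nbhd_le (hK : IsTriangulation K Ω) (hM : MeshRegular K H γ)
    (F : Finset (Finset Plane)) (hF : ∀ T ∈ F, T ∈ K.facets) (x : Plane)
    [DecidablePred fun S : Finset Plane => x ∈ nbhd K (cell S)] :
    ((F.filter fun S => x ∈ nbhd K (cell S)).card : ℝ) ≤ 64 * γ ^ 2 := by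
  refine hM.card_le hK _ (fun T hT => hF T (Finset.mem_filter.1 hT).1) x fun S hS y hy => ?_
  obtain ⟨hSF, hxS⟩ := Finset.mem_filter.1 hS
  obtain ⟨S', hS', ⟨z, hz', hz⟩, hx'⟩ := mem_nbhd_cell.1 hxS
  have h1 := (Metric.dist_le_diam_of_mem (isCompact_cell S).isBounded hy hz).trans
    (hM.2.1 S (hF S hSF))
  have h2 := (Metric.dist_le_diam_of_mem (isCompact_cell S').isBounded hz' hx').trans
    (hM.2.1 S' hS')
  rw [Metric.mem_closedBall]
  linarith [dist_triangle y z x]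

end FracturedLOD

namespace FracturedLOD

variable {K : Geometry.SimplicialComplex ℝ Plane} {Ω : Set Plane} {L : ℝ} {η : Plane → ℝ}

/-! ### Lipschitz bounds for cutoff functions -/

theorem IsCutoff.abs_sub_le_of_mem_cell (hη : IsCutoff K L η) {T : Finset Plane}
    (hT : T ∈ K.facets) {x y : Plane} (hx : x ∈ cell T) (hy : y ∈ cell T) :
    |η x - η y| ≤ L * dist x y := by
  obtain ⟨l, hl, hle⟩ := hη.affine T hT
  have h : l x - l y = l.linear (x - y) := (l.linearMap_vsub x y).symm
  rw [hl hx, hl hy, h, dist_eq_norm]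
  exact hle _

/-- A cutoff function is Lipschitz along every Lipschitz path in the triangulated set. The proof
estimates slopes to the right of a point: infinitely many nearby points of the path lie in one and
the same closed cell. -/
theorem IsCutoff.abs_sub_le_path (hK : IsTriangulation K Ω) (hη : IsCutoff K L η) (hL : 0 ≤ L)
    {p : ℝ → Plane} {M a b : ℝ} (hab : a ≤ b) (hp : ∀ s ∈ Icc a b, p s ∈ closure Ω)
    (hlip : ∀ s ∈ Icc a b, ∀ t ∈ Icc a b, dist (p s) (p t) ≤ M * |s - t|) :
    |η (p b) - η (p a)| ≤ L * M * (b - a) := by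
  have hpc : ContinuousOn p (Icc a b) :=
    (LipschitzOnWith.of_dist_le_mul (K := M.toNNReal) fun s hs t ht =>
      (hlip s hs t ht).trans (mul_le_mul_of_nonneg_right (Real.le_coe_toNNReal M)
        (abs_nonneg _))).continuousOn
  have key : ∀ σ : ℝ, |σ| = 1 → σ * (η (p b) - η (p a)) ≤ L * M * (b - a) := by
    intro σ hσ
    refine image_le_of_liminf_slope_right_le_deriv_boundary
      (f := fun s => σ * (η (p s) - η (p a))) (B := fun s => L * M * (s - a))
      (B' := fun _ => L * M) (a := a) (b := b) ?_ (by simp) (by fun_prop) ?_ ?_ ⟨hab, le_rfl⟩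
    · exact continuousOn_const.mul ((hη.continuous.comp_continuousOn hpc).sub continuousOn_const)
    · intro x _
      simpa using (((hasDerivAt_id x).sub_const a).const_mul (L * M)).hasDerivWithinAt
    · intro x hx r hr
      have hev : ∀ᶠ z in 𝓝[>] x, z ∈ Ioo x b := Ioo_mem_nhdsGT hx.2
      obtain ⟨T, hT, hfreq⟩ : ∃ T ∈ K.facets, ∃ᶠ z in 𝓝[>] x, p z ∈ cell T := by
        by_contra! hcon
        have hall : ∀ᶠ z in 𝓝[>] x, ∀ T ∈ K.facets, ¬ p z ∈ cell T :=
          (eventually_all_finite hK.finite_facets).2 fun T hT => by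
            simpa using hcon T hT
        obtain ⟨z, hz, hzab⟩ := (hall.and hev).exists
        have := hp z ⟨hx.1.trans hzab.1.le, hzab.2.le⟩
        rw [hK.closure_eq, mem_iUnion₂] at this
        obtain ⟨T, hT, hzT⟩ := this
        exact hz T hT hzT
      have hxT : p x ∈ cell T := by
        by_contra hxT
        have h1 : Tendsto p (𝓝[>] x) (𝓝 (p x)) :=
          (hpc x ⟨hx.1, hx.2.le⟩).mono_left <| by
            refine nhdsWithin_le_of_mem (mem_of_superset (Ioo_mem_nhdsGT hx.2) ?_)
            exact fun z hz => ⟨hx.1.trans hz.1.le, hz.2.le⟩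
        exact hfreq (h1.eventually ((isClosed_cell T).isOpen_compl.mem_nhds hxT))
      refine (hfreq.and_eventually hev).mono fun z hz => lt_of_le_of_lt ?_ hr
      have hzx : 0 < z - x := sub_pos.2 hz.2.1
      rw [slope_def_field, div_le_iff₀ hzx]
      calc σ * (η (p z) - η (p a)) - σ * (η (p x) - η (p a)) = σ * (η (p z) - η (p x)) := by ring
        _ ≤ |σ * (η (p z) - η (p x))| := le_abs_self _
        _ = |η (p z) - η (p x)| := by rw [abs_mul, hσ, one_mul]
        _ ≤ L * dist (p z) (p x) := hη.abs_sub_le_of_mem_cell hT hz.1 hxT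
        _ ≤ L * (M * |z - x|) := mul_le_mul_of_nonneg_left
            (hlip z ⟨hx.1.trans hz.2.1.le, hz.2.2.le⟩ x ⟨hx.1, hx.2.le⟩) hL
        _ = L * M * (z - x) := by rw [abs_of_pos hzx]; ring
  rw [abs_le]
  constructor
  · linarith [key (-1) (by simp)]
  · linarith [key 1 (by simp)]

theorem IsCutoff.abs_sub_le_of_segment (hK : IsTriangulation K Ω) (hη : IsCutoff K L η)
    (hL : 0 ≤ L) {x y : Plane} (h : segment ℝ x y ⊆ closure Ω) : |η y - η x| ≤ L * dist x y := by
  have := hη.abs_sub_le_path hK hL (p := AffineMap.lineMap x y) (M := dist x y) zero_le_one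
    (fun s hs => h (by rw [segment_eq_image_lineMap]; exact mem_image_of_mem _ hs))
    (fun s _ t _ => by rw [dist_lineMap_lineMap, Real.dist_eq, mul_comm])
  simpa using this

variable (Γ : Interface Ω)

theorem Interface.curve_mem_closure (i : Fin Γ.n) {t : ℝ} (ht : t ∈ Icc 0 (Γ.len i)) :
    Γ.curve i t ∈ closure Ω := by
  have h : MapsTo (Γ.curve i) (closure (Ioo 0 (Γ.len i))) (closure Ω) := by
    refine MapsTo.closure_of_continuousOn (fun s hs => Γ.mem_domain i s hs) ?_
    rw [closure_Ioo (Γ.len_pos i).ne]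
    exact curve_continuousOn Γ i
  rw [closure_Ioo (Γ.len_pos i).ne] at h
  exact h ht

theorem Interface.lipschitzOnWith_curve (i : Fin Γ.n) :
    LipschitzOnWith 1 (Γ.curve i) (Icc 0 (Γ.len i)) := by
  rw [← closure_Ioo (Γ.len_pos i).ne]
  refine LipschitzOnWith.closure ?_ ?_
  · rw [closure_Ioo (Γ.len_pos i).ne]
    exact curve_continuousOn Γ i
  · refine LipschitzOnWith.of_dist_le_mul fun s hs t ht => ?_
    rw [dist_eq_norm, dist_eq_norm, NNReal.coe_one]
    refine (convex_Ioo 0 (Γ.len i)).norm_image_sub_le_of_norm_deriv_le (𝕜 := ℝ) (fun r hr => ?_)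
      (fun r hr => (Γ.unit_speed i r hr).le) ht hs
    exact ((Γ.smooth i).differentiableOn (by simp) r (Ioo_subset_Icc_self hr)).differentiableAt
      (Icc_mem_nhds hr.1 hr.2)

theorem IsCutoff.lipschitzOnWith_comp_curve (hK : IsTriangulation K Ω) (hη : IsCutoff K L η)
    (hL : 0 ≤ L) (i : Fin Γ.n) :
    LipschitzOnWith L.toNNReal (η ∘ Γ.curve i) (Icc 0 (Γ.len i)) := by
  have key : ∀ s ∈ Icc 0 (Γ.len i), ∀ t ∈ Icc 0 (Γ.len i), s ≤ t →
      |η (Γ.curve i t) - η (Γ.curve i s)| ≤ L * |t - s| := by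
    intro s hs t ht hst
    have hsub : Icc s t ⊆ Icc 0 (Γ.len i) := Icc_subset_Icc hs.1 ht.2
    have := hη.abs_sub_le_path hK hL (p := Γ.curve i) (M := 1) hst
      (fun r hr => Γ.curve_mem_closure i (hsub hr)) fun r hr u hu => by
        simpa [Real.dist_eq] using (Γ.lipschitzOnWith_curve i).dist_le_mul r (hsub hr) u (hsub hu)
    rwa [mul_one, ← abs_of_nonneg (sub_nonneg.2 hst)] at this
  refine LipschitzOnWith.of_dist_le_mul fun s hs t ht => ?_
  rw [Real.coe_toNNReal _ hL, Real.dist_eq, Real.dist_eq]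
  rcases le_total s t with h | h
  · rw [abs_sub_comm s t, Function.comp, Function.comp, abs_sub_comm]
    exact key s hs t ht h
  · exact key t ht s hs h

theorem IsCutoff.ae_abs_deriv_le (hK : IsTriangulation K Ω) (hη : IsCutoff K L η) (hL : 0 ≤ L)
    (i : Fin Γ.n) :
    ∀ᵐ t ∂volume.restrict (Icc 0 (Γ.len i)), |deriv (η ∘ Γ.curve i) t| ≤ L := by
  rw [← restrict_Ioo_eq_restrict_Icc]
  refine (ae_restrict_mem measurableSet_Ioo).mono fun t ht => ?_
  have := norm_deriv_le_of_lipschitzOn (Icc_mem_nhds ht.1 ht.2)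
    (hη.lipschitzOnWith_comp_curve Γ hK hL i)
  rwa [Real.coe_toNNReal _ hL] at this

/-- The derivative of a function vanishes almost everywhere on a level set, because all but
countably many points of the level set are limits of points of the level set. -/
theorem ae_deriv_eq_zero_of_eq_const (f : ℝ → ℝ) (c : ℝ) : ∀ᵐ t, f t = c → deriv f t = 0 := by
  have hc : {t ∈ {t | f t = c} | 𝓝[{t | f t = c} ∩ Ioi t] t = ⊥}.Countable :=
    countable_setOfPred_isolated_right_within
  filter_upwards [hc.ae_notMem volume] with t ht hft
  by_cases hd : DifferentiableAt ℝ f t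
  · have hne : (𝓝[{t | f t = c} ∩ Ioi t] t).NeBot := ⟨fun h => ht ⟨hft, h⟩⟩
    have h1 := (hasDerivAt_iff_tendsto_slope.1 hd.hasDerivAt).mono_left
      (nhdsWithin_mono t (s := {t | f t = c} ∩ Ioi t) fun s hs => ne_of_gt hs.2)
    refine tendsto_nhds_unique h1 (tendsto_const_nhds.congr' ?_)
    filter_upwards [self_mem_nhdsWithin] with s hs
    have : f s = c := hs.1
    have hft' : f t = c := hft
    simp [slope_def_field, this, hft']
  · exact deriv_zero_of_not_differentiableAt hd

/-! ### Gradients and smooth approximation of cutoff functions -/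

theorem hasFDerivAt_of_eventually_sub_eq {f : Plane → ℝ} {l : Plane →ₗ[ℝ] ℝ} {x : Plane}
    (h : ∀ᶠ y in 𝓝 x, f y - f x = l (y - x)) : HasFDerivAt f l.toContinuousLinearMap x := by
  refine HasFDerivAt.of_isLittleO ?_
  refine (Asymptotics.isLittleO_zero _ _).congr' ?_ EventuallyEq.rfl
  filter_upwards [h] with y hy
  simp [hy]

theorem norm_gradient_eq (f : Plane → ℝ) (x : Plane) : ‖gradient f x‖ = ‖fderiv ℝ f x‖ := by
  rw [gradient, LinearIsometryEquiv.norm_map]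

theorem measurable_gradient (f : Plane → ℝ) : Measurable (gradient f) :=
  (InnerProductSpace.toDual ℝ Plane).symm.continuous.measurable.comp (measurable_fderiv ℝ f)

theorem IsCutoff.norm_gradient_le (hη : IsCutoff K L η) (hL : 0 ≤ L) {T : Finset Plane}
    (hT : T ∈ K.facets) {x : Plane} (hx : x ∈ interior (cell T)) : ‖gradient η x‖ ≤ L := by
  rw [norm_gradient_eq]
  refine norm_fderiv_le_of_lip' ℝ hL ?_
  filter_upwards [isOpen_interior.mem_nhds hx] with y hy
  rw [← dist_eq_norm y]
  exact hη.abs_sub_le_of_mem_cell hT (interior_subset hy) (interior_subset hx)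

theorem IsCutoff.ae_norm_gradient_le (hK : IsTriangulation K Ω) (hη : IsCutoff K L η)
    (hL : 0 ≤ L) : ∀ᵐ x ∂volume.restrict Ω, x ∈ Ω → ‖gradient η x‖ ≤ L := by
  filter_upwards [hK.ae_mem_interior_cell] with x hx hxΩ
  have h := subset_closure hxΩ
  rw [hK.closure_eq, mem_iUnion₂] at h
  obtain ⟨T, hT, hxT⟩ := h
  exact hη.norm_gradient_le hL hT (hx T hT hxT)

theorem gradient_eq_zero_of_eq_const {T : Finset Plane} {c : ℝ}
    (hc : ∀ x ∈ cell T, η x = c) {x : Plane} (hx : x ∈ interior (cell T)) : gradient η x = 0 := by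
  have h : η =ᶠ[𝓝 x] fun _ => c := by
    filter_upwards [isOpen_interior.mem_nhds hx] with y hy using hc y (interior_subset hy)
  rw [h.gradient_eq, gradient_fun_const]

/-- Mollification with a bump function of radius `ρ.rOut` changes differences of nearby values in
the same way as it changes values. -/
theorem abs_convolution_sub_sub_le {g : Plane → ℝ} (hg : Continuous g)
    (ρ : ContDiffBump (0 : Plane)) {x y : Plane} {c ε : ℝ} (hε : 0 ≤ ε)
    (h : ∀ z ∈ Metric.ball x ρ.rOut, |g (z + (y - x)) - g z - c| ≤ ε) :
    |(convolution (ρ.normed volume) g (ContinuousLinearMap.lsmul ℝ ℝ) volume) y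
      - (convolution (ρ.normed volume) g (ContinuousLinearMap.lsmul ℝ ℝ) volume) x - c| ≤ ε := by
  have hint : ∀ w : Plane, Integrable (fun t => ρ.normed volume t • g (w - t)) := fun w =>
    (ρ.continuous_normed.smul (hg.comp (continuous_const.sub continuous_id))
      ).integrable_of_hasCompactSupport ρ.hasCompactSupport_normed.smul_right
  have h1 := dist_convolution_le (μ := volume) (x₀ := x) (z₀ := c) hε
    (ρ.support_normed_eq (μ := volume)).subset ρ.nonneg_normed ρ.integral_normed
    (g := fun z => g (z + (y - x)) - g z)
    ((hg.comp (continuous_id.add continuous_const)).sub hg).aestronglyMeasurable h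
  rw [Real.dist_eq] at h1
  convert h1 using 3
  simp only [convolution, ContinuousLinearMap.lsmul_apply, smul_sub]
  rw [← integral_sub (hint y) (hint x)]
  refine integral_congr_ae (Eventually.of_forall fun t => ?_)
  have : x - t + (y - x) = y - t := by abel
  simp only [this]

/-- Smooth approximation: the mollifications of a cutoff function converge pointwise, have gradient
at most `L` away from `∂Ω`, and have the right gradient, eventually, in the interior of a cell. -/
theorem IsCutoff.exists_smooth_approx (hK : IsTriangulation K Ω) (hη : IsCutoff K L η)
    (hL : 0 ≤ L) {δ : ℕ → ℝ} (hδ : ∀ m, 0 < δ m) :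
    ∃ ζ : ℕ → Plane → ℝ, (∀ m, ContDiff ℝ ∞ (ζ m)) ∧ (∀ m x, ζ m x ∈ Icc (0 : ℝ) 1) ∧
      (∀ x, Tendsto (fun m => ζ m x) atTop (𝓝 (η x))) ∧
      (∀ m x, Metric.ball x (δ m) ⊆ Ω → ‖gradient (ζ m) x‖ ≤ L) ∧
      ∀ T ∈ K.facets, ∀ x ∈ interior (cell T), ∀ᶠ m in atTop, gradient (ζ m) x = gradient η x := by
  let ε : ℕ → ℝ := fun m => min (δ m / 2) (1 / ((m : ℝ) + 1))
  have hε : ∀ m, 0 < ε m := fun m => lt_min (half_pos (hδ m)) (by positivity)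
  have hε0 : Tendsto ε atTop (𝓝 0) :=
    squeeze_zero (fun m => (hε m).le) (fun m => min_le_right _ _)
      tendsto_one_div_add_atTop_nhds_zero_nat
  let ρ : ℕ → ContDiffBump (0 : Plane) := fun m => ⟨ε m / 2, ε m, half_pos (hε m),
    half_lt_self (hε m)⟩
  refine ⟨fun m => convolution ((ρ m).normed volume) η (ContinuousLinearMap.lsmul ℝ ℝ) volume,
    fun m => ?_, fun m x => ?_, fun x => ?_, fun m x hx => ?_, fun T hT x hx => ?_⟩
  · exact (ρ m).hasCompactSupport_normed.contDiff_convolution_left _ (ρ m).contDiff_normed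
      hη.continuous.locallyIntegrable
  · have h := dist_convolution_le (μ := volume) (x₀ := x) (z₀ := (1 / 2 : ℝ)) (ε := 1 / 2)
      (by norm_num) ((ρ m).support_normed_eq (μ := volume)).subset (ρ m).nonneg_normed
      (ρ m).integral_normed hη.continuous.aestronglyMeasurable (fun z _ => by
        have := hη.mem_Icc z
        rw [Real.dist_eq, abs_le]
        constructor <;> linarith [this.1, this.2])
    rw [Real.dist_eq, abs_le] at h
    constructor <;> linarith [h.1, h.2]
  · exact ContDiffBump.convolution_tendsto_right_of_continuous hε0 hη.continuous x
  · rw [norm_gradient_eq]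
    refine norm_fderiv_le_of_lip' ℝ hL ?_
    filter_upwards [Metric.ball_mem_nhds x (half_pos (hδ m))] with y hy
    have h := abs_convolution_sub_sub_le (x := x) (y := y) hη.continuous (ρ m) (c := 0)
      (ε := L * ‖y - x‖) (by positivity) fun z hz => ?_
    · simpa using h
    · rw [sub_zero]
      have hz2 : z ∈ Metric.ball x (δ m) := by
        refine Metric.ball_subset_ball ?_ hz
        exact (min_le_left _ _).trans (half_le_self (hδ m).le)
      have hz3 : z + (y - x) ∈ Metric.ball x (δ m) := by
        rw [Metric.mem_ball, dist_eq_norm] at hy hz ⊢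
        have h1 : ‖z - x‖ < δ m / 2 := lt_of_lt_of_le hz (min_le_left _ _)
        have h2 : z + (y - x) - x = (z - x) + (y - x) := by abel
        rw [h2]
        linarith [norm_add_le (z - x) (y - x)]
      have := hη.abs_sub_le_of_segment hK hL
        (((convex_ball x (δ m)).segment_subset hz2 hz3).trans (hx.trans subset_closure))
      simpa [dist_eq_norm, norm_sub_rev] using this
  · obtain ⟨l, hl, -⟩ := hη.affine T hT
    obtain ⟨r, hr, hrT⟩ := Metric.mem_nhds_iff.1 (mem_interior_iff_mem_nhds.1 hx)
    have hlin : ∀ y z : Plane, l y - l z = l.linear (y - z) := fun y z =>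
      (l.linearMap_vsub y z).symm
    have e2 : HasFDerivAt η l.linear.toContinuousLinearMap x := by
      refine hasFDerivAt_of_eventually_sub_eq ?_
      filter_upwards [Metric.ball_mem_nhds x hr] with y hy
      rw [hl (hrT hy), hl (hrT (Metric.mem_ball_self hr)), hlin]
    filter_upwards [hε0.eventually (gt_mem_nhds (half_pos hr))] with m hm
    have e1 := hasFDerivAt_of_eventually_sub_eq (l := l.linear) (x := x)
      (f := convolution ((ρ m).normed volume) η (ContinuousLinearMap.lsmul ℝ ℝ) volume) (by
        filter_upwards [Metric.ball_mem_nhds x (half_pos hr)] with y hy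
        have h := abs_convolution_sub_sub_le (x := x) (y := y) hη.continuous (ρ m)
          (c := l.linear (y - x)) (ε := 0) le_rfl fun z hz => ?_
        · exact sub_eq_zero.1 (abs_eq_zero.1 (le_antisymm h (abs_nonneg _)))
        · have hz1 : ‖z - x‖ < r / 2 := by
            rw [← dist_eq_norm]; exact lt_trans hz hm
          have hz2 : z ∈ cell T := hrT (by rw [Metric.mem_ball, dist_eq_norm]; linarith)
          have hz3 : z + (y - x) ∈ cell T := hrT (by
            rw [Metric.mem_ball, dist_eq_norm] at hy ⊢
            have h2 : z + (y - x) - x = (z - x) + (y - x) := by abel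
            rw [h2]
            linarith [norm_add_le (z - x) (y - x)])
          rw [hl hz2, hl hz3, hlin]
          simp)
    rw [gradient, gradient, e1.fderiv, e2.fderiv]

end FracturedLOD

namespace FracturedLOD

variable {K : Geometry.SimplicialComplex ℝ Plane} {Ω : Set Plane} {L : ℝ} {η : Plane → ℝ}

/-! ### Multiplication of functions in `V` by cutoff functions -/

/-- `h m → 0` in `L²` if it is controlled by `f m - f → 0` and by `f` times bounded factors that
tend to zero almost everywhere. -/
theorem tendsto_eLpNorm_of_le_add {α F F' : Type*} [MeasurableSpace α] [NormedAddCommGroup F]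
    [NormedAddCommGroup F'] {μ : Measure α} {f : α → F} {fs : ℕ → α → F} {h : ℕ → α → F'}
    {c : ℕ → α → ℝ} {M : ℝ} (hf : MemLp f 2 μ) (hfs : ∀ m, AEStronglyMeasurable (fs m) μ)
    (h1 : Tendsto (fun m => eLpNorm (fun x => fs m x - f x) 2 μ) atTop (𝓝 0))
    (hc : ∀ m, AEStronglyMeasurable (c m) μ) (hcM : ∀ m, ∀ᵐ x ∂μ, c m x ∈ Icc 0 M)
    (hc0 : ∀ᵐ x ∂μ, Tendsto (fun m => c m x) atTop (𝓝 0))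
    (hle : ∀ m, ∀ᵐ x ∂μ, ‖h m x‖ ≤ M * ‖fs m x - f x‖ + c m x * ‖f x‖) :
    Tendsto (fun m => eLpNorm (h m) 2 μ) atTop (𝓝 0) := by
  have e1 : Tendsto (fun m => eLpNorm (fun x => M * ‖fs m x - f x‖) 2 μ) atTop (𝓝 0) := by
    refine tendsto_smul_aux (f := fun m x => ‖fs m x - f x‖) M ?_ (fun m => EventuallyEq.rfl)
    simpa only [eLpNorm_norm] using h1
  have e2 : Tendsto (fun m => eLpNorm (fun x => c m x * ‖f x‖) 2 μ) atTop (𝓝 0) := by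
    have hlim : Tendsto (fun m => ∫⁻ x, ‖c m x * ‖f x‖‖ₑ ^ (2 : ℝ) ∂μ) atTop
        (𝓝 (∫⁻ _, 0 ∂μ)) := by
      refine tendsto_lintegral_of_dominated_convergence' (fun x => ‖M * ‖f x‖‖ₑ ^ (2 : ℝ))
        (fun m => ((hc m).mul hf.1.norm).enorm.pow_const _) (fun m => ?_) ?_ ?_
      · filter_upwards [hcM m] with x hx
        refine ENNReal.rpow_le_rpow (enorm_le_iff_norm_le.2 ?_) (by norm_num)
        rw [norm_mul, norm_mul, Real.norm_of_nonneg hx.1, Real.norm_of_nonneg (hx.1.trans hx.2)]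
        exact mul_le_mul_of_nonneg_right hx.2 (norm_nonneg _)
      · have := ((hf.norm.const_mul M).eLpNorm_lt_top)
        rw [eLpNorm_eq_lintegral_rpow_enorm_toReal (by norm_num) (by norm_num)] at this
        have h2 := (ENNReal.rpow_lt_top_iff_of_pos (by norm_num)).1 this
        simpa using h2.ne
      · filter_upwards [hc0] with x hx
        have h3 : Tendsto (fun m => ‖c m x * ‖f x‖‖ₑ) atTop (𝓝 0) := by
          have := (hx.mul_const ‖f x‖).enorm
          simpa using this
        have := h3.ennrpow_const (2 : ℝ)
        simpa using this
    have h4 := hlim.ennrpow_const (1 / 2 : ℝ)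
    simp only [lintegral_const, zero_mul] at h4
    rw [ENNReal.zero_rpow_of_pos (by norm_num)] at h4
    refine h4.congr fun m => ?_
    rw [eLpNorm_eq_lintegral_rpow_enorm_toReal (by norm_num) (by norm_num)]
    norm_num
  have e3 := e1.add e2
  rw [add_zero] at e3
  refine tendsto_of_tendsto_of_tendsto_of_le_of_le tendsto_const_nhds e3 (fun _ => zero_le)
    fun m => ?_
  refine (eLpNorm_mono_ae_real (hle m)).trans ?_
  exact eLpNorm_add_le (((hfs m).sub hf.1).norm.const_mul M) ((hc m).mul hf.1.norm) (by norm_num)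

theorem memLp_smul_of_norm_le {α F : Type*} [MeasurableSpace α] [NormedAddCommGroup F]
    [NormedSpace ℝ F] {μ : Measure α} {f : α → F} {c : α → ℝ} {C : ℝ} (hf : MemLp f 2 μ)
    (hc : AEStronglyMeasurable c μ) (hcC : ∀ᵐ x ∂μ, ‖c x‖ ≤ C) :
    MemLp (fun x => c x • f x) 2 μ := by
  refine hf.of_le_mul (c := C) (hc.smul hf.1) ?_
  filter_upwards [hcC] with x hx
  rw [norm_smul]
  exact mul_le_mul_of_nonneg_right hx (norm_nonneg _)

theorem gradient_mul {f g : Plane → ℝ} {x : Plane} (hf : DifferentiableAt ℝ f x)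
    (hg : DifferentiableAt ℝ g x) :
    gradient (fun y => f y * g y) x = f x • gradient g x + g x • gradient f x := by
  simp only [gradient]
  rw [fderiv_fun_mul hf hg, map_add, map_smulₛₗ, map_smulₛₗ]
  rfl

variable {Γ : Interface Ω}

/-- The product of a Lipschitz function and the primitive of an `L²` function is the primitive of
the derivative given by the product rule. -/
theorem mul_eq_integral_of_lipschitz {θ g d : ℝ → ℝ} {t : ℝ} (ht : 0 ≤ t) {C : NNReal}
    (hθ : LipschitzOnWith C θ (Icc 0 t)) (hd : IntervalIntegrable d volume 0 t)
    (hg : ∀ s ∈ Icc 0 t, g s = g 0 + ∫ r in (0)..s, d r) :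
    θ t * g t = θ 0 * g 0 + ∫ s in (0)..t, (θ s * d s + deriv θ s * g s) := by
  let G : ℝ → ℝ := fun s => g 0 + ∫ r in (0)..s, d r
  have hθ' : AbsolutelyContinuousOnInterval θ 0 t :=
    LipschitzOnWith.absolutelyContinuousOnInterval (by rwa [uIcc_of_le ht])
  have hG1 : AbsolutelyContinuousOnInterval (fun s => ∫ r in (0)..s, d r) 0 t :=
    hd.absolutelyContinuousOnInterval_intervalIntegral (by simp)
  have hconst : AbsolutelyContinuousOnInterval (fun _ : ℝ => g 0) 0 t :=
    (LipschitzWith.const (g 0)).lipschitzOnWith.absolutelyContinuousOnInterval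
  have hG : AbsolutelyContinuousOnInterval G 0 t := hconst.add hG1
  have h := hθ'.integral_deriv_mul_eq_sub hG
  have hG0 : G 0 = g 0 := by simp [G]
  have hGt : G t = g t := (hg t ⟨ht, le_rfl⟩).symm
  rw [hG0, hGt] at h
  have hcongr : ∫ s in (0)..t, (θ s * d s + deriv θ s * g s)
      = ∫ s in (0)..t, deriv θ s * G s + θ s * deriv G s := by
    refine intervalIntegral.integral_congr_ae ?_
    filter_upwards [hd.ae_hasDerivAt_integral] with s hs hst
    have hmem : s ∈ uIcc 0 t := uIoc_subset_uIcc hst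
    have h1 : deriv G s = d s := ((hs hmem 0 (by simp)).const_add (g 0)).deriv
    have h2 : G s = g s := (hg s (by rwa [uIcc_of_le ht] at hmem)).symm
    rw [h1, h2]; ring
  rw [hcongr, h]; ring

/-- The support of a test function has a positive distance to `∂Ω`, even if it is empty. -/
theorem exists_ball_subset_of_tsupport_subset (hΩ : IsOpen Ω) {f : Plane → ℝ}
    (hf : HasCompactSupport f) (hs : tsupport f ⊆ Ω) :
    ∃ δ > 0, ∀ x ∈ tsupport f, Metric.ball x δ ⊆ Ω := by
  obtain ⟨δ, hδ, h⟩ := IsCompact.exists_thickening_subset_open hf hΩ hs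
  exact ⟨δ, hδ, fun x hx => (Metric.ball_subset_thickening hx δ).trans h⟩

/-- Multiplication by a cutoff function maps `V` into itself, and the product rule holds for the
gradient and for the tangential gradient. Approximants of the product are products of the
approximants with mollifications of the cutoff function, at scales so small that the gradients
remain bounded on the supports. -/
theorem IsCutoff.exists_mul (hΩ : IsOpen Ω) (hK : IsTriangulation K Ω) (hη : IsCutoff K L η)
    (hL : 0 ≤ L) (v : energySpace Γ) :
    ∃ w : energySpace Γ,
      (∀ᵐ x ∂volume.restrict Ω, grad w x = η x • grad v x + bulk v x • gradient η x) ∧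
      ∀ i, ∀ᵐ t ∂volume.restrict (Icc 0 (Γ.len i)),
        tgrad w i t = η (Γ.curve i t) * tgrad v i t
          + deriv (η ∘ Γ.curve i) t * trace v i t := by
  obtain ⟨⟨u, G, g, d⟩, ⟨φ, hφ, h1, h2, h3⟩, ⟨e, he, hed⟩⟩ := v
  dsimp only at h1 h2 h3 hed
  have hcη : ∀ i, ContinuousOn (fun t => η (Γ.curve i t)) (Icc 0 (Γ.len i)) := fun i =>
    hη.continuous.comp_continuousOn (curve_continuousOn Γ i)
  have hmη : ∀ i, AEStronglyMeasurable (fun t => η (Γ.curve i t))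
      (volume.restrict (Icc 0 (Γ.len i))) := fun i =>
    (hcη i).aestronglyMeasurable measurableSet_Icc
  have hηn : ∀ x, ‖η x‖ ≤ 1 := fun x => by
    rw [Real.norm_of_nonneg (hη.mem_Icc x).1]; exact (hη.mem_Icc x).2
  have hgradL : ∀ᵐ x ∂volume.restrict Ω, ‖gradient η x‖ ≤ L := by
    filter_upwards [hη.ae_norm_gradient_le hK hL, ae_restrict_mem hΩ.measurableSet] with x hx hxΩ
      using hx hxΩ
  have mu : MemLp (fun x => η x * u x) 2 (volume.restrict Ω) :=
    memLp_smul_of_norm_le (Lp.memLp u) hη.continuous.aestronglyMeasurable (Eventually.of_forall hηn)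
  have mG : MemLp (fun x => η x • G x + u x • gradient η x) 2 (volume.restrict Ω) := by
    refine MemLp.add ?_ ?_
    · exact memLp_smul_of_norm_le (Lp.memLp G) hη.continuous.aestronglyMeasurable
        (Eventually.of_forall hηn)
    · refine (Lp.memLp u).of_le_mul (c := L)
        ((Lp.aestronglyMeasurable u).smul (measurable_gradient η).aestronglyMeasurable) ?_
      filter_upwards [hgradL] with x hx
      rw [norm_smul, mul_comm]
      exact mul_le_mul_of_nonneg_right hx (norm_nonneg _)
  have mg : ∀ i, MemLp (fun t => η (Γ.curve i t) * g i t) 2 (volume.restrict (Icc 0 (Γ.len i))) :=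
    fun i => memLp_smul_of_norm_le (Lp.memLp (g i)) (hmη i) (Eventually.of_forall fun t => hηn _)
  have md : ∀ i, MemLp (fun t => η (Γ.curve i t) * d i t + deriv (η ∘ Γ.curve i) t * g i t) 2
      (volume.restrict (Icc 0 (Γ.len i))) := fun i =>
    (memLp_smul_of_norm_le (Lp.memLp (d i)) (hmη i) (Eventually.of_forall fun t => hηn _)).add
      (memLp_smul_of_norm_le (Lp.memLp (g i)) (measurable_deriv _).aestronglyMeasurable
        (hη.ae_abs_deriv_le Γ hK hL i))
  let w : Data Γ := (mu.toLp _, mG.toLp _, fun i => (mg i).toLp _, fun i => (md i).toLp _)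
  have hw1 : IsH10WithTrace Γ w := by
    choose δ hδ hball using fun m =>
      exists_ball_subset_of_tsupport_subset hΩ (hφ m).2.1 (hφ m).2.2
    obtain ⟨ζ, hζs, hζI, hζη, hζL, hζg⟩ := hη.exists_smooth_approx hK hL hδ
    have hdist : ∀ m x, |ζ m x - η x| ∈ Icc (0 : ℝ) 1 := fun m x => by
      refine ⟨abs_nonneg _, abs_le.2 ⟨?_, ?_⟩⟩ <;>
        linarith [(hζI m x).1, (hζI m x).2, (hη.mem_Icc x).1, (hη.mem_Icc x).2]
    have hdist0 : ∀ x, Tendsto (fun m => |ζ m x - η x|) atTop (𝓝 0) := fun x => by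
      have := ((hζη x).sub_const (η x)).abs
      simpa using this
    have hζn : ∀ m x, ‖ζ m x‖ ≤ 1 := fun m x => by
      rw [Real.norm_of_nonneg (hζI m x).1]; exact (hζI m x).2
    -- the estimate behind the convergence of a product with `ζ m`
    have hprod : ∀ {F : Type} [NormedAddCommGroup F] [NormedSpace ℝ F] (m : ℕ) (x : Plane)
        (a b : F), ‖ζ m x • a - η x • b‖ ≤ 1 * ‖a - b‖ + |ζ m x - η x| * ‖b‖ := by
      intro F _ _ m x a b
      have : ζ m x • a - η x • b = ζ m x • (a - b) + (ζ m x - η x) • b := by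
        rw [smul_sub, sub_smul]; abel
      rw [this]
      refine (norm_add_le _ _).trans (add_le_add ?_ (norm_smul _ _).le)
      rw [norm_smul]
      exact mul_le_mul_of_nonneg_right (hζn m x) (norm_nonneg _)
    refine ⟨fun m x => ζ m x * φ m x, fun m => ⟨(hζs m).mul (hφ m).1, (hφ m).2.1.mul_left, ?_⟩,
      ?_, ?_, fun i => ?_⟩
    · exact (tsupport_mul_subset_right (f := ζ m) (g := φ m)).trans (hφ m).2.2
    · refine tendsto_eLpNorm_of_le_add (Lp.memLp u)
        (fun m => (hφ m).1.continuous.aestronglyMeasurable) h1 (M := 1)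
        (c := fun m x => |ζ m x - η x|)
        (fun m => ((hζs m).continuous.sub hη.continuous).abs.aestronglyMeasurable)
        (fun m => Eventually.of_forall (hdist m)) (Eventually.of_forall hdist0) fun m => ?_
      filter_upwards [mu.coeFn_toLp] with x hx
      rw [hx]
      exact hprod m x (φ m x) (u x)
    · have hG : Tendsto (fun m => eLpNorm (fun x => ζ m x • gradient (φ m) x - η x • G x) 2
          (volume.restrict Ω)) atTop (𝓝 0) := by
        refine tendsto_eLpNorm_of_le_add (Lp.memLp G)
          (fun m => (continuous_gradient (hφ m).1).aestronglyMeasurable) h2 (M := 1)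
          (c := fun m x => |ζ m x - η x|)
          (fun m => ((hζs m).continuous.sub hη.continuous).abs.aestronglyMeasurable)
          (fun m => Eventually.of_forall (hdist m)) (Eventually.of_forall hdist0) fun m => ?_
        exact Eventually.of_forall fun x => hprod m x _ _
      have hmeas : ∀ m, Measurable ((tsupport (φ m)).indicator
          fun x => ‖gradient (ζ m) x - gradient η x‖) := fun m =>
        ((measurable_gradient _).sub (measurable_gradient _)).norm.indicator
          (isClosed_tsupport _).measurableSet
      have hu : Tendsto (fun m => eLpNorm (fun x => φ m x • gradient (ζ m) x - u x • gradient η x) 2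
          (volume.restrict Ω)) atTop (𝓝 0) := by
        refine tendsto_eLpNorm_of_le_add (Lp.memLp u)
          (fun m => (hφ m).1.continuous.aestronglyMeasurable) h1 (M := 2 * L)
          (c := fun m => (tsupport (φ m)).indicator
            fun x => ‖gradient (ζ m) x - gradient η x‖)
          (fun m => (hmeas m).aestronglyMeasurable) (fun m => ?_) ?_ fun m => ?_
        · filter_upwards [hgradL] with x hx
          by_cases hxs : x ∈ tsupport (φ m)
          · rw [indicator_of_mem hxs]
            refine ⟨norm_nonneg _, (norm_sub_le _ _).trans ?_⟩
            linarith [hζL m x (hball m x hxs)]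
          · rw [indicator_of_notMem hxs]
            exact ⟨le_rfl, by positivity⟩
        · filter_upwards [hK.ae_mem_interior_cell, ae_restrict_mem hΩ.measurableSet] with x hx hxΩ
          have h := subset_closure hxΩ
          rw [hK.closure_eq, mem_iUnion₂] at h
          obtain ⟨T, hT, hxT⟩ := h
          refine tendsto_const_nhds.congr' ?_
          filter_upwards [hζg T hT x (hx T hT hxT)] with m hm
          exact (indicator_apply_eq_zero.2 fun _ => by rw [hm, sub_self, norm_zero]).symm
        · filter_upwards [hgradL] with x hx
          by_cases hxs : x ∈ tsupport (φ m)
          · rw [indicator_of_mem hxs]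
            have : φ m x • gradient (ζ m) x - u x • gradient η x
                = (φ m x - u x) • gradient (ζ m) x + u x • (gradient (ζ m) x - gradient η x) := by
              rw [smul_sub, sub_smul]; abel
            rw [this]
            refine (norm_add_le _ _).trans (add_le_add ?_ ?_)
            · rw [norm_smul, mul_comm]
              refine mul_le_mul_of_nonneg_right ?_ (norm_nonneg _)
              linarith [hζL m x (hball m x hxs)]
            · rw [norm_smul, mul_comm]
          · rw [indicator_of_notMem hxs, image_eq_zero_of_notMem_tsupport hxs]
            simp only [zero_smul, zero_sub, norm_neg, zero_mul, add_zero, norm_smul]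
            rw [mul_comm]
            refine mul_le_mul_of_nonneg_right ?_ (norm_nonneg _)
            linarith
      refine tendsto_add_aux (fun m => ?_) (fun m => ?_) hG hu fun m => ?_
      · exact ((hζs m).continuous.aestronglyMeasurable.smul
          (continuous_gradient (hφ m).1).aestronglyMeasurable).sub
          (hη.continuous.aestronglyMeasurable.smul (Lp.aestronglyMeasurable G))
      · exact ((hφ m).1.continuous.aestronglyMeasurable.smul
          (continuous_gradient (hζs m)).aestronglyMeasurable).sub
          ((Lp.aestronglyMeasurable u).smul (measurable_gradient η).aestronglyMeasurable)
      · filter_upwards [mG.coeFn_toLp] with x hx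
        simp only [Pi.add_apply]
        rw [hx, gradient_mul ((hζs m).differentiable (by simp) x)
          ((hφ m).1.differentiable (by simp) x)]
        abel
    · have hcont : ∀ {f : Plane → ℝ}, Continuous f → AEStronglyMeasurable
          (fun t => f (Γ.curve i t)) (volume.restrict (Icc 0 (Γ.len i))) := fun hf =>
        (hf.comp_continuousOn (curve_continuousOn Γ i)).aestronglyMeasurable measurableSet_Icc
      refine tendsto_eLpNorm_of_le_add (Lp.memLp (g i))
        (fun m => hcont (hφ m).1.continuous) (h3 i) (M := 1)
        (c := fun m t => |ζ m (Γ.curve i t) - η (Γ.curve i t)|)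
        (fun m => hcont ((hζs m).continuous.sub hη.continuous).abs)
        (fun m => Eventually.of_forall fun t => hdist m _)
        (Eventually.of_forall fun t => hdist0 _) fun m => ?_
      filter_upwards [(mg i).coeFn_toLp] with t ht
      rw [ht]
      exact hprod m (Γ.curve i t) (φ m (Γ.curve i t)) (g i t)
  have hw2 : IsH1Interface Γ w := by
    refine ⟨fun x => η x * e x, hη.continuous.continuousOn.mul he, fun i => ⟨?_, fun t ht => ?_⟩⟩
    · filter_upwards [(mg i).coeFn_toLp, (hed i).1] with t ht ht'
      rw [ht, ht']
    · have hsub : Icc 0 t ⊆ Icc 0 (Γ.len i) := Icc_subset_Icc le_rfl ht.2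
      have hae : w.2.2.2 i =ᵐ[volume.restrict (Icc 0 (Γ.len i))]
          fun s => η (Γ.curve i s) * d i s + deriv (η ∘ Γ.curve i) s * e (Γ.curve i s) := by
        filter_upwards [(md i).coeFn_toLp, (hed i).1] with s hs hs'
        rw [hs, hs']
      rw [integral_congr_lp hae ht]
      exact mul_eq_integral_of_lipschitz (θ := η ∘ Γ.curve i) (g := fun s => e (Γ.curve i s)) ht.1
        ((hη.lipschitzOnWith_comp_curve Γ hK hL i).mono hsub) (lp_intervalIntegrable (d i) ht)
        fun s hs => (hed i).2 s (hsub hs)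
  exact ⟨⟨w, hw1, hw2⟩, mG.coeFn_toLp, fun i => (md i).coeFn_toLp⟩

end FracturedLOD

namespace FracturedLOD

/-! ### Pointwise estimates integrated over a measure space -/

section Abstract

variable {X F : Type*} [MeasurableSpace X] {μ : Measure X} [NormedAddCommGroup F]
  [InnerProductSpace ℝ F] {a : X → ℝ} {p q : X → F} {α β : ℝ}

theorem integrable_coeff_mul_inner (ha : AEMeasurable a μ) (hα : 0 ≤ α)
    (hab : ∀ᵐ x ∂μ, α ≤ a x ∧ a x ≤ β) (hp : MemLp p 2 μ) (hq : MemLp q 2 μ) :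
    Integrable (fun x => a x * inner ℝ (p x) (q x)) μ := by
  refine ((hp.norm.integrable_mul hq.norm).const_mul β).mono
    (ha.aestronglyMeasurable.mul (hp.1.inner hq.1)) ?_
  filter_upwards [hab] with x hx
  have h0 : 0 ≤ a x := hα.trans hx.1
  rw [norm_mul, norm_mul, Real.norm_of_nonneg h0, Real.norm_of_nonneg (h0.trans hx.2)]
  refine mul_le_mul hx.2 ?_ (norm_nonneg _) (h0.trans hx.2)
  refine (norm_inner_le_norm _ _).trans (le_abs_self _)

/-- Young's inequality for a weighted `L²` inner product, with a second factor that vanishes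
outside `R`. -/
theorem abs_integral_inner_le (hα : 0 ≤ α) (hab : ∀ᵐ x ∂μ, α ≤ a x ∧ a x ≤ β) (hp : MemLp p 2 μ)
    (hq : MemLp q 2 μ) {R : Set X} (hR : MeasurableSet R) (hz : ∀ᵐ x ∂μ, x ∉ R → q x = 0) {s : ℝ}
    (hs : 0 < s) :
    |∫ x, a x * inner ℝ (p x) (q x) ∂μ| ≤
      β / 2 * (s * (∫ x in R, ‖p x‖ ^ 2 ∂μ) + s⁻¹ * ∫ x in R, ‖q x‖ ^ 2 ∂μ) := by
  have hip : Integrable (fun x => ‖p x‖ ^ 2) μ := hp.integrable_norm_pow (by norm_num)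
  have hiq : Integrable (fun x => ‖q x‖ ^ 2) μ := hq.integrable_norm_pow (by norm_num)
  have hig : Integrable (fun x => β / 2 * (s * ‖p x‖ ^ 2 + s⁻¹ * ‖q x‖ ^ 2)) μ :=
    ((hip.const_mul s).add (hiq.const_mul s⁻¹)).const_mul _
  have hle : ∀ᵐ x ∂μ, ‖a x * inner ℝ (p x) (q x)‖ ≤
      R.indicator (fun x => β / 2 * (s * ‖p x‖ ^ 2 + s⁻¹ * ‖q x‖ ^ 2)) x := by
    filter_upwards [hab, hz] with x hx hzx
    by_cases hxR : x ∈ R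
    · rw [indicator_of_mem hxR, norm_mul]
      have h0 : 0 ≤ a x := hα.trans hx.1
      rw [Real.norm_of_nonneg h0]
      have h2 : ‖p x‖ * ‖q x‖ ≤ (s * ‖p x‖ ^ 2 + s⁻¹ * ‖q x‖ ^ 2) / 2 := by
        have h3 : s * ‖p x‖ ^ 2 + s⁻¹ * ‖q x‖ ^ 2 - 2 * (‖p x‖ * ‖q x‖)
            = s⁻¹ * (s * ‖p x‖ - ‖q x‖) ^ 2 := by
          field_simp; ring
        have : 0 ≤ s⁻¹ * (s * ‖p x‖ - ‖q x‖) ^ 2 := by positivity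
        linarith
      calc a x * ‖inner ℝ (p x) (q x)‖ ≤ β * (‖p x‖ * ‖q x‖) :=
            mul_le_mul hx.2 (norm_inner_le_norm _ _) (norm_nonneg _) (h0.trans hx.2)
        _ ≤ β * ((s * ‖p x‖ ^ 2 + s⁻¹ * ‖q x‖ ^ 2) / 2) :=
            mul_le_mul_of_nonneg_left h2 (h0.trans hx.2)
        _ = _ := by ring
    · rw [indicator_of_notMem hxR, hzx hxR]
      simp
  have h := norm_integral_le_of_norm_le (hig.indicator hR) hle
  rw [integral_indicator hR, integral_const_mul,
    integral_add (hip.integrableOn.const_mul s) (hiq.integrableOn.const_mul s⁻¹),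
    integral_const_mul, integral_const_mul] at h
  exact h

/-- Lower bound for the weighted `L²` inner product of `p` and a product `η p + z D`, in the form
that the product rule takes for a cutoff function `η` with gradient `D`. -/
theorem le_integral_inner_cutoff (ha : AEMeasurable a μ) (hα : 0 ≤ α)
    (hab : ∀ᵐ x ∂μ, α ≤ a x ∧ a x ≤ β) (hp : MemLp p 2 μ) (hq : MemLp q 2 μ) {O W : Set X}
    (hO : MeasurableSet O) (hW : MeasurableSet W) {η z : X → ℝ} {D : X → F} {L : ℝ}
    (hz : MemLp z 2 μ) (hη : ∀ᵐ x ∂μ, 0 ≤ η x) (hηO : ∀ᵐ x ∂μ, x ∈ O → 1 ≤ η x)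
    (hqη : ∀ᵐ x ∂μ, q x = η x • p x + z x • D x) (hD : ∀ᵐ x ∂μ, ‖D x‖ ≤ L)
    (hDW : ∀ᵐ x ∂μ, x ∉ W → D x = 0) :
    α * (∫ x in O, ‖p x‖ ^ 2 ∂μ) ≤ (∫ x, a x * inner ℝ (p x) (q x) ∂μ) +
      β / 2 * (L ^ 2 * (∫ x in W, z x ^ 2 ∂μ) + ∫ x in W, ‖p x‖ ^ 2 ∂μ) := by
  have hip : Integrable (fun x => ‖p x‖ ^ 2) μ := hp.integrable_norm_pow (by norm_num)
  have hiz : Integrable (fun x => z x ^ 2) μ := hz.integrable_sq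
  have hig : Integrable (fun x => β / 2 * (L ^ 2 * z x ^ 2 + ‖p x‖ ^ 2)) μ :=
    ((hiz.const_mul _).add hip).const_mul _
  have hia := integrable_coeff_mul_inner ha hα hab hp hq
  have hle : (O.indicator fun x => α * ‖p x‖ ^ 2) ≤ᵐ[μ] fun x => a x * inner ℝ (p x) (q x) +
      W.indicator (fun x => β / 2 * (L ^ 2 * z x ^ 2 + ‖p x‖ ^ 2)) x := by
    filter_upwards [hab, hη, hηO, hqη, hD, hDW] with x hx hη0 hη1 hqx hDx hDWx
    have h0 : 0 ≤ a x := hα.trans hx.1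
    have h1 : O.indicator (fun x => α * ‖p x‖ ^ 2) x ≤ a x * (η x * ‖p x‖ ^ 2) := by
      by_cases hxO : x ∈ O
      · rw [indicator_of_mem hxO]
        refine mul_le_mul hx.1 ?_ (by positivity) h0
        exact le_mul_of_one_le_left (by positivity) (hη1 hxO)
      · rw [indicator_of_notMem hxO]
        positivity
    have h2 : a x * inner ℝ (p x) (q x)
        = a x * (η x * ‖p x‖ ^ 2) + a x * (z x * inner ℝ (p x) (D x)) := by
      rw [hqx, inner_add_right, inner_smul_right, inner_smul_right, real_inner_self_eq_norm_sq]
      ring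
    have h3 : -(a x * (z x * inner ℝ (p x) (D x))) ≤
        W.indicator (fun x => β / 2 * (L ^ 2 * z x ^ 2 + ‖p x‖ ^ 2)) x := by
      by_cases hxW : x ∈ W
      · rw [indicator_of_mem hxW]
        have h4 : |inner ℝ (p x) (D x)| ≤ ‖p x‖ * L :=
          (abs_real_inner_le_norm _ _).trans (mul_le_mul_of_nonneg_left hDx (norm_nonneg _))
        calc -(a x * (z x * inner ℝ (p x) (D x))) ≤ |a x * (z x * inner ℝ (p x) (D x))| :=
              neg_le_abs _
          _ = a x * (|z x| * |inner ℝ (p x) (D x)|) := by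
              rw [abs_mul, abs_mul, abs_of_nonneg h0]
          _ ≤ β * (|z x| * (‖p x‖ * L)) :=
              mul_le_mul hx.2 (mul_le_mul_of_nonneg_left h4 (abs_nonneg _)) (by positivity)
                (h0.trans hx.2)
          _ ≤ β * ((L ^ 2 * z x ^ 2 + ‖p x‖ ^ 2) / 2) := by
              refine mul_le_mul_of_nonneg_left ?_ (h0.trans hx.2)
              have := sq_nonneg (L * |z x| - ‖p x‖)
              rw [sub_sq, mul_pow, sq_abs] at this
              linarith
          _ = _ := by ring
      · rw [indicator_of_notMem hxW, hDWx hxW]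
        simp
    linarith
  have h := integral_mono_ae ((hip.const_mul α).indicator hO) (hia.add (hig.indicator hW)) hle
  simp only [Pi.add_apply] at h
  rw [integral_indicator hO, integral_add hia (hig.indicator hW), integral_indicator hW,
    integral_const_mul, integral_const_mul,
    integral_add (hiz.integrableOn.const_mul _) hip.integrableOn, integral_const_mul] at h
  exact h

/-- Upper bound for the squared `L²` norm of a product `η p + z D`, in the form that the product
rule takes for a cutoff function `η` with gradient `D`. -/
theorem integral_norm_sq_add_smul_le (hp : MemLp p 2 μ) (hq : MemLp q 2 μ) {W : Set X}
    (hW : MeasurableSet W) {η z : X → ℝ} {D : X → F} {L : ℝ} (hz : MemLp z 2 μ)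
    (hη : ∀ᵐ x ∂μ, |η x| ≤ 1) (hqη : ∀ᵐ x ∂μ, q x = η x • p x + z x • D x)
    (hD : ∀ᵐ x ∂μ, ‖D x‖ ≤ L) (hDW : ∀ᵐ x ∂μ, x ∉ W → D x = 0) :
    (∫ x, ‖q x‖ ^ 2 ∂μ) ≤ 2 * (∫ x, ‖p x‖ ^ 2 ∂μ) + 2 * L ^ 2 * ∫ x in W, z x ^ 2 ∂μ := by
  have hip : Integrable (fun x => ‖p x‖ ^ 2) μ := hp.integrable_norm_pow (by norm_num)
  have hiq : Integrable (fun x => ‖q x‖ ^ 2) μ := hq.integrable_norm_pow (by norm_num)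
  have hiz : Integrable (fun x => z x ^ 2) μ := hz.integrable_sq
  have hle : (fun x => ‖q x‖ ^ 2) ≤ᵐ[μ] fun x => 2 * ‖p x‖ ^ 2 +
      W.indicator (fun x => 2 * L ^ 2 * z x ^ 2) x := by
    filter_upwards [hη, hqη, hD, hDW] with x hηx hqx hDx hDWx
    have h1 : ‖η x • p x‖ ≤ ‖p x‖ := by
      rw [norm_smul]; exact mul_le_of_le_one_left (norm_nonneg _) hηx
    by_cases hxW : x ∈ W
    · rw [indicator_of_mem hxW]
      have h2 : ‖z x • D x‖ ≤ |z x| * L := by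
        rw [norm_smul]; exact mul_le_mul_of_nonneg_left hDx (norm_nonneg _)
      have h3 : ‖q x‖ ≤ ‖p x‖ + |z x| * L := by
        rw [hqx]; exact (norm_add_le _ _).trans (add_le_add h1 h2)
      have h4 := pow_le_pow_left₀ (norm_nonneg _) h3 2
      have h5 := sq_nonneg (‖p x‖ - |z x| * L)
      rw [add_sq, mul_pow, sq_abs] at h4
      rw [sub_sq, mul_pow, sq_abs] at h5
      linarith
    · rw [indicator_of_notMem hxW, hqx, hDWx hxW, smul_zero, add_zero, add_zero]
      have := pow_le_pow_left₀ (norm_nonneg _) h1 2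
      linarith [sq_nonneg ‖p x‖]
  have h := integral_mono_ae hiq ((hip.const_mul 2).add ((hiz.const_mul _).indicator hW)) hle
  simp only [Pi.add_apply] at h
  rwa [integral_add (hip.const_mul 2) ((hiz.const_mul _).indicator hW), integral_indicator hW,
    integral_const_mul, integral_const_mul] at h

/-- If no point is in more than `N` sets of a family, then the sum of their measures is at most `N`
times the measure of any set that contains them all. -/
theorem sum_measureReal_le_of_overlap {ι : Type*} [IsFiniteMeasure μ] (F : Finset ι)
    {s : ι → Set X} {S : Set X} (hs : ∀ i ∈ F, MeasurableSet (s i)) (hS : MeasurableSet S)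
    (hsub : ∀ i ∈ F, s i ⊆ S) {N : ℝ} [∀ x, DecidablePred fun i => x ∈ s i]
    (hN : ∀ x, ((F.filter fun i => x ∈ s i).card : ℝ) ≤ N) :
    ∑ i ∈ F, μ.real (s i) ≤ N * μ.real S := by
  have h1 : ∀ i ∈ F, μ.real (s i) = ∫ x, (s i).indicator (fun _ => (1 : ℝ)) x ∂μ := fun i hi => by
    rw [integral_indicator (hs i hi)]; simp
  have hint : ∀ i ∈ F, Integrable ((s i).indicator fun _ => (1 : ℝ)) μ := fun i hi =>
    (integrable_const _).indicator (hs i hi)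
  rw [Finset.sum_congr rfl h1, ← integral_finsetSum F hint]
  calc ∫ x, ∑ i ∈ F, (s i).indicator (fun _ => (1 : ℝ)) x ∂μ
      ≤ ∫ x, S.indicator (fun _ => N) x ∂μ := by
        refine integral_mono (integrable_finsetSum F hint) ((integrable_const N).indicator hS)
          fun x => ?_
        have h2 : ∑ i ∈ F, (s i).indicator (fun _ => (1 : ℝ)) x
            = ((F.filter fun i => x ∈ s i).card : ℝ) := by
          simp only [indicator_apply, Finset.sum_boole]
        simp only [h2]
        by_cases hx : x ∈ S
        · rw [indicator_of_mem hx]; exact hN x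
        · rw [indicator_of_notMem hx, Nat.cast_nonpos, Finset.card_eq_zero,
            Finset.filter_eq_empty_iff]
          exact fun i hi h => hx (hsub i hi h)
    _ = N * μ.real S := by
        rw [integral_indicator hS]; simp [mul_comm]

end Abstract

/-! ### Local energies -/

variable {Ω : Set Plane} {Γ : Interface Ω}

theorem Interface.isClosed_param (i : Fin Γ.n) {S : Set Plane} (hS : IsClosed S) :
    IsClosed (Γ.param i S) :=
  (curve_continuousOn Γ i).preimage_isClosed_of_isClosed isClosed_Icc hS

theorem Interface.param_inter (i : Fin Γ.n) (S R : Set Plane) :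
    Γ.param i R ∩ Γ.param i S = Γ.param i (S ∩ R) := by
  ext t; simp only [Interface.param, mem_inter_iff, mem_preimage]; tauto

variable (Γ) in
/-- The measure on the plane whose density on `Ω` is the square of `f`, and whose density on the
`i`-th curve with respect to arc length is the square of `h i`. -/
noncomputable def sqMeasure {F : Type*} [NormedAddCommGroup F] (f : Plane → F)
    (h : Fin Γ.n → ℝ → ℝ) : Measure Plane :=
  (volume.restrict Ω).withDensity (fun x => ‖f x‖ₑ ^ 2) +
    ∑ i, ((volume.restrict (Icc 0 (Γ.len i))).withDensity (fun t => ‖h i t‖ₑ ^ 2)).map (Γ.curve i)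

theorem lintegral_enorm_sq_eq {X F : Type*} [MeasurableSpace X] {μ : Measure X}
    [NormedAddCommGroup F] {f : X → F} (hf : MemLp f 2 μ) :
    ∫⁻ x, ‖f x‖ₑ ^ 2 ∂μ = ENNReal.ofReal (∫ x, ‖f x‖ ^ 2 ∂μ) := by
  rw [ofReal_integral_eq_lintegral_ofReal (hf.integrable_norm_pow (by norm_num))
    (Eventually.of_forall fun x => by positivity)]
  refine lintegral_congr fun x => ?_
  rw [ENNReal.ofReal_pow (norm_nonneg _), ofReal_norm]

section SqMeasure

variable {F : Type*} [NormedAddCommGroup F] {f : Plane → F} {h : Fin Γ.n → ℝ → ℝ}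

theorem sqMeasure_apply (hf : MemLp f 2 (volume.restrict Ω))
    (hh : ∀ i, MemLp (h i) 2 (volume.restrict (Icc 0 (Γ.len i)))) {S : Set Plane}
    (hS : IsClosed S) :
    sqMeasure Γ f h S = ENNReal.ofReal ((∫ x in Ω ∩ S, ‖f x‖ ^ 2) +
      ∑ i, ∫ t in Γ.param i S, h i t ^ 2) := by
  have h1 : (volume.restrict Ω).withDensity (fun x => ‖f x‖ₑ ^ 2) S
      = ENNReal.ofReal (∫ x in Ω ∩ S, ‖f x‖ ^ 2) := by
    rw [withDensity_apply _ hS.measurableSet, lintegral_enorm_sq_eq (hf.restrict S),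
      Measure.restrict_restrict hS.measurableSet, inter_comm]
  have h2 : ∀ i, ((volume.restrict (Icc 0 (Γ.len i))).withDensity
      (fun t => ‖h i t‖ₑ ^ 2)).map (Γ.curve i) S
      = ENNReal.ofReal (∫ t in Γ.param i S, h i t ^ 2) := by
    intro i
    have hm : AEMeasurable (Γ.curve i) ((volume.restrict (Icc 0 (Γ.len i))).withDensity
        (fun t => ‖h i t‖ₑ ^ 2)) :=
      ((curve_continuousOn Γ i).aemeasurable measurableSet_Icc).mono_ac
        (withDensity_absolutelyContinuous _ _)
    rw [Measure.map_apply_of_aemeasurable hm hS.measurableSet, withDensity_apply',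
      lintegral_enorm_sq_eq ((hh i).restrict _), Measure.restrict_restrict' measurableSet_Icc,
      inter_comm]
    simp only [Real.norm_eq_abs, sq_abs, Interface.param]
  have hn : ∀ i ∈ Finset.univ, 0 ≤ ∫ t in Γ.param i S, h i t ^ 2 := fun i _ =>
    integral_nonneg fun t => sq_nonneg _
  rw [sqMeasure, Measure.add_apply, Measure.finsetSum_apply, h1,
    Finset.sum_congr rfl fun i _ => h2 i,
    ENNReal.ofReal_add (integral_nonneg fun x => by positivity) (Finset.sum_nonneg hn),
    ENNReal.ofReal_sum_of_nonneg hn]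

theorem sqMeasure_real (hf : MemLp f 2 (volume.restrict Ω))
    (hh : ∀ i, MemLp (h i) 2 (volume.restrict (Icc 0 (Γ.len i)))) {S : Set Plane}
    (hS : IsClosed S) :
    (sqMeasure Γ f h).real S = (∫ x in Ω ∩ S, ‖f x‖ ^ 2) + ∑ i, ∫ t in Γ.param i S, h i t ^ 2 := by
  rw [Measure.real, sqMeasure_apply hf hh hS, ENNReal.toReal_ofReal]
  exact add_nonneg (integral_nonneg fun x => by positivity)
    (Finset.sum_nonneg fun i _ => integral_nonneg fun t => sq_nonneg _)

theorem isFiniteMeasure_sqMeasure (hf : MemLp f 2 (volume.restrict Ω))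
    (hh : ∀ i, MemLp (h i) 2 (volume.restrict (Icc 0 (Γ.len i)))) :
    IsFiniteMeasure (sqMeasure Γ f h) :=
  ⟨by rw [sqMeasure_apply hf hh isClosed_univ]; exact ENNReal.ofReal_lt_top⟩

/-- The sum of norms used in the definitions is equivalent to the square root of the measure. -/
theorem sqMeasure_real_le_sq (hf : MemLp f 2 (volume.restrict Ω))
    (hh : ∀ i, MemLp (h i) 2 (volume.restrict (Icc 0 (Γ.len i)))) {S : Set Plane}
    (hS : IsClosed S) :
    (sqMeasure Γ f h).real S ≤ (bulkNorm Ω S f + interfaceNorm Γ S h) ^ 2 ∧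
      (bulkNorm Ω S f + interfaceNorm Γ S h) ^ 2 ≤ 2 * (sqMeasure Γ f h).real S := by
  have h1 : bulkNorm Ω S f ^ 2 = ∫ x in Ω ∩ S, ‖f x‖ ^ 2 :=
    Real.sq_sqrt (integral_nonneg fun x => by positivity)
  have h2 : interfaceNorm Γ S h ^ 2 = ∑ i, ∫ t in Γ.param i S, h i t ^ 2 :=
    Real.sq_sqrt (Finset.sum_nonneg fun i _ => integral_nonneg fun t => sq_nonneg _)
  rw [sqMeasure_real hf hh hS, ← h1, ← h2]
  have h3 : 0 ≤ bulkNorm Ω S f := Real.sqrt_nonneg _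
  have h4 : 0 ≤ interfaceNorm Γ S h := Real.sqrt_nonneg _
  constructor
  · nlinarith [mul_nonneg h3 h4]
  · nlinarith [sq_nonneg (bulkNorm Ω S f - interfaceNorm Γ S h)]

end SqMeasure

variable (v w : energySpace Γ)

theorem memLp_grad : MemLp (grad v) 2 (volume.restrict Ω) := Lp.memLp v.1.2.1

theorem memLp_bulk : MemLp (bulk v) 2 (volume.restrict Ω) := Lp.memLp v.1.1

theorem memLp_trace (i : Fin Γ.n) : MemLp (trace v i) 2 (volume.restrict (Icc 0 (Γ.len i))) :=
  Lp.memLp (v.1.2.2.1 i)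

theorem memLp_tgrad (i : Fin Γ.n) : MemLp (tgrad v i) 2 (volume.restrict (Icc 0 (Γ.len i))) :=
  Lp.memLp (v.1.2.2.2 i)

/-- The energy density `|∇v|²` on `Ω` and `|∇_τ v|²` on `Γ`, as a measure on the plane. -/
noncomputable def energyMeasure : Measure Plane := sqMeasure Γ (grad v) (tgrad v)

/-- The mass density `v²` on `Ω` and on `Γ`, as a measure on the plane. -/
noncomputable def massMeasure : Measure Plane := sqMeasure Γ (bulk v) (trace v)

instance : IsFiniteMeasure (energyMeasure v) :=
  isFiniteMeasure_sqMeasure (memLp_grad v) (memLp_tgrad v)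

instance : IsFiniteMeasure (massMeasure v) :=
  isFiniteMeasure_sqMeasure (memLp_bulk v) (memLp_trace v)

variable {v w} {S R : Set Plane}

theorem energyMeasure_real (hS : IsClosed S) : (energyMeasure v).real S =
    (∫ x in Ω ∩ S, ‖grad v x‖ ^ 2) + ∑ i, ∫ t in Γ.param i S, tgrad v i t ^ 2 :=
  sqMeasure_real (memLp_grad v) (memLp_tgrad v) hS

theorem massMeasure_real (hS : IsClosed S) : (massMeasure v).real S =
    (∫ x in Ω ∩ S, bulk v x ^ 2) + ∑ i, ∫ t in Γ.param i S, trace v i t ^ 2 := by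
  have : (massMeasure v).real S = _ := sqMeasure_real (memLp_bulk v) (memLp_trace v) hS
  simpa only [Real.norm_eq_abs, sq_abs] using this

theorem energyMeasure_real_le_sq (hS : IsClosed S) :
    (energyMeasure v).real S ≤ gradNorm S v ^ 2 :=
  (sqMeasure_real_le_sq (memLp_grad v) (memLp_tgrad v) hS).1

theorem gradNorm_sq_le (hS : IsClosed S) : gradNorm S v ^ 2 ≤ 2 * (energyMeasure v).real S :=
  (sqMeasure_real_le_sq (memLp_grad v) (memLp_tgrad v) hS).2

theorem massMeasure_real_le_sq (hS : IsClosed S) : (massMeasure v).real S ≤ valueNorm S v ^ 2 :=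
  (sqMeasure_real_le_sq (memLp_bulk v) (memLp_trace v) hS).1

theorem gradNorm_nonneg (S : Set Plane) (v : energySpace Γ) : 0 ≤ gradNorm S v :=
  add_nonneg (Real.sqrt_nonneg _) (Real.sqrt_nonneg _)

theorem valueNorm_nonneg (S : Set Plane) (v : energySpace Γ) : 0 ≤ valueNorm S v :=
  add_nonneg (Real.sqrt_nonneg _) (Real.sqrt_nonneg _)

/-- The gradient and the tangential gradient of `v` vanish almost everywhere in `S`. -/
def GradVanishesOn (S : Set Plane) (v : energySpace Γ) : Prop :=
  (∀ᵐ x ∂volume.restrict Ω, x ∈ S → grad v x = 0) ∧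
    ∀ i, ∀ᵐ t ∂volume.restrict (Icc 0 (Γ.len i)), Γ.curve i t ∈ S → tgrad v i t = 0

theorem energyMeasure_real_eq_zero_iff (hS : IsClosed S) :
    (energyMeasure v).real S = 0 ↔ GradVanishesOn S v := by
  have hmp : ∀ i, MeasurableSet (Γ.param i S) := fun i => (Γ.isClosed_param i hS).measurableSet
  have hsub : ∀ i, Γ.param i S ⊆ Icc 0 (Γ.len i) := fun i => inter_subset_left
  have hb : (∫ x in Ω ∩ S, ‖grad v x‖ ^ 2) = 0 ↔
      ∀ᵐ x ∂volume.restrict Ω, x ∈ S → grad v x = 0 := by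
    rw [inter_comm, ← Measure.restrict_restrict hS.measurableSet, integral_eq_zero_iff_of_nonneg
      (fun x => by positivity)
      (((memLp_grad v).restrict S).integrable_norm_pow (by norm_num)),
      EventuallyEq, ae_restrict_iff' hS.measurableSet]
    simp
  have hc : ∀ i, (∫ t in Γ.param i S, tgrad v i t ^ 2) = 0 ↔
      ∀ᵐ t ∂volume.restrict (Icc 0 (Γ.len i)), Γ.curve i t ∈ S → tgrad v i t = 0 := by
    intro i
    rw [← inter_eq_left.2 (hsub i), ← Measure.restrict_restrict (hmp i),
      integral_eq_zero_iff_of_nonneg (fun t => sq_nonneg _)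
        ((memLp_tgrad v i).restrict (Γ.param i S)).integrable_sq,
      EventuallyEq, ae_restrict_iff' (hmp i)]
    have hIcc := ae_restrict_mem (μ := volume) (measurableSet_Icc (a := 0) (b := Γ.len i))
    constructor
    · intro h
      filter_upwards [h, hIcc] with t ht htI htS
      simpa using ht ⟨htI, htS⟩
    · intro h
      filter_upwards [h] with t ht htS
      simpa using ht htS.2
  have hn : ∀ i ∈ Finset.univ, 0 ≤ ∫ t in Γ.param i S, tgrad v i t ^ 2 := fun i _ =>
    integral_nonneg fun t => sq_nonneg _
  rw [energyMeasure_real hS, add_eq_zero_iff_of_nonneg (integral_nonneg fun x => by positivity)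
    (Finset.sum_nonneg hn), Finset.sum_eq_zero_iff_of_nonneg hn, hb]
  simp only [Finset.mem_univ, true_implies, hc, GradVanishesOn]

/-! ### The bilinear form -/

section Form

variable {A AΓ : Plane → ℝ} {α β : ℝ}

theorem grad_sub (v w : energySpace Γ) :
    ∀ᵐ x ∂volume.restrict Ω, grad (v - w) x = grad v x - grad w x :=
  Lp.coeFn_sub v.1.2.1 w.1.2.1

theorem tgrad_sub (v w : energySpace Γ) (i : Fin Γ.n) :
    ∀ᵐ t ∂volume.restrict (Icc 0 (Γ.len i)), tgrad (v - w) i t = tgrad v i t - tgrad w i t :=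
  Lp.coeFn_sub (v.1.2.2.2 i) (w.1.2.2.2 i)

variable (S) in
theorem form_eq (A AΓ : Plane → ℝ) (v w : energySpace Γ) :
    form A AΓ S v w = (∫ x in Ω ∩ S, A x * inner ℝ (grad v x) (grad w x)) +
      ∑ i, ∫ t in Γ.param i S, AΓ (Γ.curve i t) * inner ℝ (tgrad v i t) (tgrad w i t) := by
  simp only [form, RCLike.inner_apply, conj_trivial, mul_comm (tgrad w _ _)]

theorem form_sub_right (hα : 0 ≤ α) (hA : CoefficientBounds Γ A AΓ α β)
    (u v w : energySpace Γ) :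
    form A AΓ S u (v - w) = form A AΓ S u v - form A AΓ S u w := by
  have hΩ : volume.restrict (Ω ∩ S) ≤ volume.restrict Ω :=
    Measure.restrict_mono inter_subset_left le_rfl
  have hI : ∀ i, volume.restrict (Γ.param i S) ≤ volume.restrict (Icc 0 (Γ.len i)) := fun i =>
    Measure.restrict_mono inter_subset_left le_rfl
  have hb : ∀ w : energySpace Γ, Integrable (fun x => A x * inner ℝ (grad u x) (grad w x))
      (volume.restrict (Ω ∩ S)) := fun w =>
    (integrable_coeff_mul_inner hA.1 hα hA.2.1 (memLp_grad u) (memLp_grad w)).mono_measure hΩ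
  have hc : ∀ (w : energySpace Γ) i, Integrable
      (fun t => AΓ (Γ.curve i t) * inner ℝ (tgrad u i t) (tgrad w i t))
      (volume.restrict (Γ.param i S)) := fun w i =>
    (integrable_coeff_mul_inner (hA.2.2 i).1 hα (hA.2.2 i).2 (memLp_tgrad u i)
      (memLp_tgrad w i)).mono_measure (hI i)
  have e1 : (∫ x in Ω ∩ S, A x * inner ℝ (grad u x) (grad (v - w) x)) =
      (∫ x in Ω ∩ S, A x * inner ℝ (grad u x) (grad v x)) -
        ∫ x in Ω ∩ S, A x * inner ℝ (grad u x) (grad w x) := by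
    rw [← integral_sub (hb v) (hb w)]
    refine integral_congr_ae (Eventually.mono (ae_mono hΩ (grad_sub v w)) fun x hx => ?_)
    simp only [hx, inner_sub_right, mul_sub]
  have e2 : ∀ i,
      (∫ t in Γ.param i S, AΓ (Γ.curve i t) * inner ℝ (tgrad u i t) (tgrad (v - w) i t)) =
      (∫ t in Γ.param i S, AΓ (Γ.curve i t) * inner ℝ (tgrad u i t) (tgrad v i t)) -
        ∫ t in Γ.param i S, AΓ (Γ.curve i t) * inner ℝ (tgrad u i t) (tgrad w i t) := by
    intro i
    rw [← integral_sub (hc v i) (hc w i)]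
    refine integral_congr_ae (Eventually.mono (ae_mono (hI i) (tgrad_sub v w i)) fun x hx => ?_)
    simp only [hx, inner_sub_right, mul_sub]
  rw [form_eq, form_eq, form_eq, e1, Finset.sum_congr rfl fun i _ => e2 i, Finset.sum_sub_distrib]
  ring

/-- Young's inequality for the bilinear form, with a second argument whose gradient vanishes
outside `R`. -/
theorem abs_form_le (hα : 0 ≤ α) (hA : CoefficientBounds Γ A AΓ α β) (hS : IsClosed S)
    (hR : IsClosed R) (hw : GradVanishesOn (S \ R) w) {s : ℝ} (hs : 0 < s) :
    |form A AΓ S v w| ≤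
      β / 2 * (s * (energyMeasure v).real (S ∩ R) + s⁻¹ * (energyMeasure w).real (S ∩ R)) := by
  have hΩ : volume.restrict (Ω ∩ S) ≤ volume.restrict Ω :=
    Measure.restrict_mono inter_subset_left le_rfl
  have hI : ∀ i, volume.restrict (Γ.param i S) ≤ volume.restrict (Icc 0 (Γ.len i)) := fun i =>
    Measure.restrict_mono inter_subset_left le_rfl
  have hmem : ∀ᵐ x ∂volume.restrict (Ω ∩ S), x ∈ S := by
    rw [inter_comm, ← Measure.restrict_restrict hS.measurableSet]
    exact ae_restrict_mem hS.measurableSet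
  have hb := abs_integral_inner_le (μ := volume.restrict (Ω ∩ S)) hα
    (ae_mono hΩ hA.2.1) ((memLp_grad v).mono_measure hΩ) ((memLp_grad w).mono_measure hΩ)
    hR.measurableSet (by
      filter_upwards [ae_mono hΩ hw.1, hmem] with x hx hxS hxR
      exact hx ⟨hxS, hxR⟩) hs
  have hc : ∀ i, _ := fun i =>
    abs_integral_inner_le (μ := volume.restrict (Γ.param i S)) (R := Γ.param i R)
      hα (ae_mono (hI i) (hA.2.2 i).2)
      ((memLp_tgrad v i).mono_measure (hI i)) ((memLp_tgrad w i).mono_measure (hI i))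
      (Γ.isClosed_param i hR).measurableSet (by
        filter_upwards [ae_mono (hI i) (hw.2 i),
          ae_restrict_mem (Γ.isClosed_param i hS).measurableSet] with t ht htS htR
        exact ht ⟨htS.2, fun h => htR ⟨htS.1, h⟩⟩) hs
  rw [Measure.restrict_restrict hR.measurableSet,
    show R ∩ (Ω ∩ S) = Ω ∩ (S ∩ R) by rw [inter_comm, inter_assoc]] at hb
  simp only [Measure.restrict_restrict (Γ.isClosed_param _ hR).measurableSet,
    Interface.param_inter] at hc
  rw [form_eq, energyMeasure_real (hS.inter hR), energyMeasure_real (hS.inter hR)]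
  refine (abs_add_le _ _).trans ((add_le_add hb ((Finset.abs_sum_le_sum_abs _ _).trans
    (Finset.sum_le_sum fun i _ => hc i))).trans_eq ?_)
  simp only [Real.norm_eq_abs, sq_abs, ← Finset.mul_sum, Finset.sum_add_distrib]
  ring

theorem form_eq_zero (hα : 0 ≤ α) (hA : CoefficientBounds Γ A AΓ α β) (hS : IsClosed S)
    (hw : GradVanishesOn S w) : form A AΓ S v w = 0 := by
  have := abs_form_le (v := v) (R := ∅) hα hA hS isClosed_empty (by simpa using hw) one_pos
  simpa using this

/-- `w` is the product of `v` and a function `η` with values in `[0, 1]`, whose gradient is `D` on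
`Ω` and whose derivatives along the curves are `Dτ`; these are bounded by `L`, and vanish
outside `W`. -/
structure IsCutoffProduct (η : Plane → ℝ) (D : Plane → Plane) (Dτ : Fin Γ.n → ℝ → ℝ) (L : ℝ)
    (W : Set Plane) (v w : energySpace Γ) : Prop where
  mem_Icc : ∀ x, η x ∈ Icc (0 : ℝ) 1
  bound : ∀ᵐ x ∂volume.restrict Ω, ‖D x‖ ≤ L ∧ (x ∉ W → D x = 0)
  bound_curve : ∀ i, ∀ᵐ t ∂volume.restrict (Icc 0 (Γ.len i)),
    |Dτ i t| ≤ L ∧ (Γ.curve i t ∉ W → Dτ i t = 0)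
  grad_eq : ∀ᵐ x ∂volume.restrict Ω, grad w x = η x • grad v x + bulk v x • D x
  tgrad_eq : ∀ i, ∀ᵐ t ∂volume.restrict (Icc 0 (Γ.len i)),
    tgrad w i t = η (Γ.curve i t) * tgrad v i t + Dτ i t * trace v i t

variable {W : Set Plane} {η : Plane → ℝ} {D : Plane → Plane} {Dτ : Fin Γ.n → ℝ → ℝ} {L : ℝ}

/-- The energy of a product in `S` is controlled by the energy of `v` in `S` and the mass of `v` in
the part of `S` where the cutoff function varies. -/
theorem IsCutoffProduct.energyMeasure_le (h : IsCutoffProduct η D Dτ L W v w) (hS : IsClosed S)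
    (hW : IsClosed W) : (energyMeasure w).real S ≤
      2 * (energyMeasure v).real S + 2 * L ^ 2 * (massMeasure v).real (S ∩ W) := by
  have hΩ : volume.restrict (Ω ∩ S) ≤ volume.restrict Ω :=
    Measure.restrict_mono inter_subset_left le_rfl
  have hI : ∀ i, volume.restrict (Γ.param i S) ≤ volume.restrict (Icc 0 (Γ.len i)) := fun i =>
    Measure.restrict_mono inter_subset_left le_rfl
  have habs : ∀ x, |η x| ≤ 1 := fun x => by
    rw [abs_of_nonneg (h.mem_Icc x).1]; exact (h.mem_Icc x).2
  have hb := integral_norm_sq_add_smul_le (μ := volume.restrict (Ω ∩ S))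
    ((memLp_grad v).mono_measure hΩ) ((memLp_grad w).mono_measure hΩ) hW.measurableSet
    ((memLp_bulk v).mono_measure hΩ) (Eventually.of_forall habs) (ae_mono hΩ h.grad_eq)
    (Eventually.mono (ae_mono hΩ h.bound) fun x hx => hx.1)
    (Eventually.mono (ae_mono hΩ h.bound) fun x hx => hx.2)
  have hc : ∀ i, _ := fun i =>
    integral_norm_sq_add_smul_le (μ := volume.restrict (Γ.param i S)) (W := Γ.param i W)
      (η := fun t => η (Γ.curve i t)) (D := Dτ i) (L := L)
      ((memLp_tgrad v i).mono_measure (hI i)) ((memLp_tgrad w i).mono_measure (hI i))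
      (Γ.isClosed_param i hW).measurableSet
      ((memLp_trace v i).mono_measure (hI i)) (Eventually.of_forall fun t => habs _)
      (by
        filter_upwards [ae_mono (hI i) (h.tgrad_eq i)] with t ht
        rw [ht, smul_eq_mul, smul_eq_mul, mul_comm (trace v i t)])
      (Eventually.mono (ae_mono (hI i) (h.bound_curve i)) fun t ht => ht.1)
      (by
        filter_upwards [ae_mono (hI i) (h.bound_curve i),
          ae_restrict_mem (Γ.isClosed_param i hS).measurableSet] with t ht htS htW
        exact ht.2 fun h => htW ⟨htS.1, h⟩)
  rw [Measure.restrict_restrict hW.measurableSet,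
    show W ∩ (Ω ∩ S) = Ω ∩ (S ∩ W) by rw [inter_comm, inter_assoc]] at hb
  simp only [Measure.restrict_restrict (Γ.isClosed_param _ hW).measurableSet,
    Interface.param_inter] at hc
  have hsum := add_le_add hb (Finset.sum_le_sum fun i (_ : i ∈ Finset.univ) => hc i)
  rw [energyMeasure_real hS, energyMeasure_real hS, massMeasure_real (hS.inter hW)]
  refine le_of_eq_of_le ?_ (hsum.trans_eq ?_)
  · simp only [Real.norm_eq_abs, sq_abs]
  · simp only [Real.norm_eq_abs, sq_abs, ← Finset.mul_sum, Finset.sum_add_distrib]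
    ring

/-- If `w = η v`, then `a(v, w)` controls the energy of `v` in a set where `η = 1`, up to the mass
and the energy of `v` in the set where `η` varies. -/
theorem IsCutoffProduct.le_form (h : IsCutoffProduct η D Dτ L W v w) (hΩ : IsOpen Ω) (hα : 0 ≤ α)
    (hA : CoefficientBounds Γ A AΓ α β) {O : Set Plane} (hO : IsClosed O) (hW : IsClosed W)
    (hηO : ∀ x ∈ closure Ω, x ∈ O → η x = 1) :
    α * (energyMeasure v).real O ≤ form A AΓ univ v w +
      β / 2 * (L ^ 2 * (massMeasure v).real W + (energyMeasure v).real W) := by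
  have hη : ∀ x, 0 ≤ η x := fun x => (h.mem_Icc x).1
  have hIcc : ∀ i, ∀ᵐ t ∂volume.restrict (Icc 0 (Γ.len i)), t ∈ Icc 0 (Γ.len i) := fun i =>
    ae_restrict_mem measurableSet_Icc
  have hb := le_integral_inner_cutoff hA.1 hα hA.2.1 (memLp_grad v) (memLp_grad w)
    hO.measurableSet hW.measurableSet (memLp_bulk v) (Eventually.of_forall hη)
    (by
      filter_upwards [ae_restrict_mem hΩ.measurableSet] with x hx
        using fun hxO => (hηO x (subset_closure hx) hxO).ge)
    h.grad_eq (h.bound.mono fun x hx => hx.1) (h.bound.mono fun x hx => hx.2)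
  have hc : ∀ i, _ := fun i =>
    le_integral_inner_cutoff (hA.2.2 i).1 hα (hA.2.2 i).2 (memLp_tgrad v i) (memLp_tgrad w i)
      (Γ.isClosed_param i hO).measurableSet (Γ.isClosed_param i hW).measurableSet
      (memLp_trace v i) (η := fun t => η (Γ.curve i t)) (D := Dτ i) (L := L)
      (Eventually.of_forall fun t => hη _)
      (by
        filter_upwards [hIcc i] with t ht htO using (hηO _ (Γ.curve_mem_closure i ht) htO.2).ge)
      (by
        filter_upwards [h.tgrad_eq i] with t ht
        rw [ht, smul_eq_mul, smul_eq_mul, mul_comm (trace v i t)])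
      ((h.bound_curve i).mono fun t ht => ht.1)
      (by
        filter_upwards [h.bound_curve i, hIcc i] with t ht htI htW using ht.2 fun h => htW ⟨htI, h⟩)
  have hres : ∀ i, ∀ S : Set Plane, Γ.param i S ∩ Icc 0 (Γ.len i) = Γ.param i S := fun i S =>
    inter_eq_left.2 inter_subset_left
  rw [Measure.restrict_restrict hO.measurableSet, Measure.restrict_restrict hW.measurableSet,
    inter_comm O, inter_comm W] at hb
  simp only [Measure.restrict_restrict (Γ.isClosed_param _ hO).measurableSet,
    Measure.restrict_restrict (Γ.isClosed_param _ hW).measurableSet, hres] at hc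
  have hsum := add_le_add hb (Finset.sum_le_sum fun i (_ : i ∈ Finset.univ) => hc i)
  rw [form_eq, energyMeasure_real hO, energyMeasure_real hW, massMeasure_real hW]
  have hu : ∀ i, Γ.param i univ = Icc 0 (Γ.len i) := fun i => by simp [Interface.param]
  simp only [hu, inter_univ]
  refine le_of_eq_of_le ?_ (hsum.trans_eq ?_)
  · simp only [Real.norm_eq_abs, sq_abs, ← Finset.mul_sum]
    ring
  · simp only [Real.norm_eq_abs, sq_abs, ← Finset.mul_sum, Finset.sum_add_distrib]
    ring

end Form

end FracturedLOD

namespace FracturedLOD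

variable {K : Geometry.SimplicialComplex ℝ Plane} {Ω : Set Plane} {Γ : Interface Ω} {H γ C : ℝ}

/-! ### Interpolation on unions of cells -/

theorem IsTriangulation.exists_mem_cell (hK : IsTriangulation K Ω) {x : Plane}
    (hx : x ∈ closure Ω) : ∃ T ∈ K.facets, x ∈ cell T := by
  simpa only [hK.closure_eq, mem_iUnion₂, exists_prop] using hx

theorem GradVanishesOn.biUnion {F : Set (Finset Plane)} (hF : F.Finite) {v : energySpace Γ}
    (h : ∀ S ∈ F, GradVanishesOn (cell S) v) : GradVanishesOn (⋃ S ∈ F, cell S) v := by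
  refine ⟨?_, fun i => ?_⟩
  · filter_upwards [(ae_ball_iff hF.countable).2 fun S hS => (h S hS).1] with x hx hxS
    obtain ⟨S, hS, hxS⟩ := mem_iUnion₂.1 hxS
    exact hx S hS hxS
  · filter_upwards [(ae_ball_iff hF.countable).2 fun S hS => (h S hS).2 i] with x hx hxS
    obtain ⟨S, hS, hxS⟩ := mem_iUnion₂.1 hxS
    exact hx S hS hxS

theorem GradVanishesOn.compl_biUnion (hΩ : IsOpen Ω) (hK : IsTriangulation K Ω)
    {F : Set (Finset Plane)} {v : energySpace Γ}
    (h : ∀ S ∈ K.facets, S ∉ F → GradVanishesOn (cell S) v) :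
    GradVanishesOn (univ \ ⋃ S ∈ F, cell S) v := by
  have h' := GradVanishesOn.biUnion (hK.finite_facets.subset (sdiff_subset (t := F)))
    (v := v) fun S hS => h S hS.1 hS.2
  have hmem : ∀ x ∈ closure Ω, x ∈ univ \ ⋃ S ∈ F, cell S → x ∈ ⋃ S ∈ K.facets \ F, cell S := by
    intro x hx hxF
    obtain ⟨S, hS, hxS⟩ := hK.exists_mem_cell hx
    exact mem_biUnion ⟨hS, fun hSF => hxF.2 (mem_biUnion hSF hxS)⟩ hxS
  refine ⟨?_, fun i => ?_⟩
  · filter_upwards [h'.1, ae_restrict_mem hΩ.measurableSet] with x hx hxΩ hxF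
    exact hx (hmem x (subset_closure hxΩ) hxF)
  · filter_upwards [h'.2 i, ae_restrict_mem measurableSet_Icc] with t ht htI htF
    exact ht (hmem _ (Γ.curve_mem_closure i htI) htF)

/-- Local estimates on cells by the neighbourhoods of the cells add up, because the neighbourhoods
have finite overlap. -/
theorem MeshRegular.measureReal_biUnion_le (hK : IsTriangulation K Ω) (hM : MeshRegular K H γ)
    {μ ν : Measure Plane} [IsFiniteMeasure μ] [IsFiniteMeasure ν] {c : ℝ} (hc : 0 ≤ c)
    {F : Set (Finset Plane)} (hF : F ⊆ K.facets)
    (h : ∀ S ∈ F, μ.real (cell S) ≤ c * ν.real (nbhd K (cell S))) {R : Set Plane}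
    (hR : IsClosed R) (hsub : ∀ S ∈ F, nbhd K (cell S) ⊆ R) :
    μ.real (⋃ S ∈ F, cell S) ≤ c * (64 * γ ^ 2) * ν.real R := by
  classical
  have hfin := hK.finite_facets.subset hF
  have hmem : ∀ S, S ∈ hfin.toFinset ↔ S ∈ F := fun S => hfin.mem_toFinset
  have hU : (⋃ S ∈ F, cell S) = ⋃ S ∈ hfin.toFinset, cell S := by simp only [hmem]
  have h1 : ∑ S ∈ hfin.toFinset, ν.real (nbhd K (cell S)) ≤ 64 * γ ^ 2 * ν.real R :=
    sum_measureReal_le_of_overlap _ (fun S _ => (hK.isClosed_nbhd _).measurableSet)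
      hR.measurableSet (fun S hS => hsub S ((hmem S).1 hS))
      fun x => hM.card_filter_nbhd_le hK _ (fun S hS => hF ((hmem S).1 hS)) x
  calc μ.real (⋃ S ∈ F, cell S) ≤ ∑ S ∈ hfin.toFinset, μ.real (cell S) := by
        rw [hU]; exact measureReal_biUnion_finset_le _ _
    _ ≤ ∑ S ∈ hfin.toFinset, c * ν.real (nbhd K (cell S)) :=
        Finset.sum_le_sum fun S hS => h S ((hmem S).1 hS)
    _ = c * ∑ S ∈ hfin.toFinset, ν.real (nbhd K (cell S)) := (Finset.mul_sum ..).symm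
    _ ≤ c * (64 * γ ^ 2 * ν.real R) := mul_le_mul_of_nonneg_left h1 hc
    _ = _ := by ring

section Interpolation

variable {I : energySpace Γ →ₗ[ℝ] coarseSpace Γ K}

/-- Interpolation is stable in the energy, locally. -/
theorem InterpolationBounds.energyMeasure_le (hK : IsTriangulation K Ω)
    (hI : InterpolationBounds K H C I) (v : energySpace Γ) {S : Finset Plane} (hS : S ∈ K.facets) :
    (energyMeasure (I v : energySpace Γ)).real (cell S) ≤
      2 * C ^ 2 * (energyMeasure v).real (nbhd K (cell S)) := by
  calc _ ≤ gradNorm (cell S) (I v : energySpace Γ) ^ 2 := energyMeasure_real_le_sq (isClosed_cell S)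
    _ ≤ (C * gradNorm (nbhd K (cell S)) v) ^ 2 :=
        pow_le_pow_left₀ (gradNorm_nonneg _ _) (hI v S hS).2 2
    _ = C ^ 2 * gradNorm (nbhd K (cell S)) v ^ 2 := mul_pow _ _ _
    _ ≤ C ^ 2 * (2 * (energyMeasure v).real (nbhd K (cell S))) :=
        mul_le_mul_of_nonneg_left (gradNorm_sq_le (hK.isClosed_nbhd _)) (sq_nonneg C)
    _ = _ := by ring

/-- A Poincaré inequality for functions in the kernel of the interpolation operator. -/
theorem InterpolationBounds.massMeasure_le (hK : IsTriangulation K Ω)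
    (hI : InterpolationBounds K H C I) {v : energySpace Γ} (hv : v ∈ fineSpace I)
    {S : Finset Plane} (hS : S ∈ K.facets) :
    (massMeasure v).real (cell S) ≤
      2 * C ^ 2 * H ^ 2 * (energyMeasure v).real (nbhd K (cell S)) := by
  have h0 : I v = 0 := hv
  have h := (hI v S hS).1
  rw [h0, Submodule.coe_zero, sub_zero] at h
  calc _ ≤ valueNorm (cell S) v ^ 2 := massMeasure_real_le_sq (isClosed_cell S)
    _ ≤ (C * H * gradNorm (nbhd K (cell S)) v) ^ 2 :=
        pow_le_pow_left₀ (valueNorm_nonneg _ _) h 2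
    _ = (C * H) ^ 2 * gradNorm (nbhd K (cell S)) v ^ 2 := mul_pow _ _ _
    _ ≤ (C * H) ^ 2 * (2 * (energyMeasure v).real (nbhd K (cell S))) :=
        mul_le_mul_of_nonneg_left (gradNorm_sq_le (hK.isClosed_nbhd _)) (sq_nonneg _)
    _ = _ := by ring

theorem InterpolationBounds.gradVanishesOn (hK : IsTriangulation K Ω)
    (hI : InterpolationBounds K H C I) {v : energySpace Γ} {S : Finset Plane} (hS : S ∈ K.facets)
    (h : GradVanishesOn (nbhd K (cell S)) v) : GradVanishesOn (cell S) (I v : energySpace Γ) := by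
  have h0 := (energyMeasure_real_eq_zero_iff (hK.isClosed_nbhd _)).2 h
  have h1 := (hI.energyMeasure_le hK v hS).trans_eq (mul_eq_zero_of_right _ h0)
  exact (energyMeasure_real_eq_zero_iff (isClosed_cell S)).1 (le_antisymm h1 measureReal_nonneg)

theorem interpolation_sub (v w : energySpace Γ) : I v = I (v - w) + I w := by
  have h : v = (v - w) + w := (sub_add_cancel v w).symm
  exact (congrArg I h).trans (I.map_add (v - w) w)

theorem sub_mem_fineSpace {v w : energySpace Γ} (h : I v = I w) : v - w ∈ fineSpace I := by
  have h1 : I (v - w) = 0 := right_eq_add.1 (h.symm.trans (interpolation_sub v w))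
  exact h1

theorem interpolation_sub_eq {v : energySpace Γ} (hv : v ∈ fineSpace I) (w : energySpace Γ) :
    I (w - v) = I w := by
  have h0 : I v = 0 := hv
  exact ((interpolation_sub w v).trans (add_eq_left.2 h0)).symm

/-- If the gradient of `v` vanishes around a cell, then the gradient of its interpolant vanishes on
the cell. -/
theorem InterpolationBounds.gradVanishesOn_of_nbhd (hK : IsTriangulation K Ω)
    (hI : InterpolationBounds K H C I) {v : energySpace Γ} {S : Finset Plane} (hS : S ∈ K.facets)
    (h : ∀ S' ∈ K.facets, (cell S' ∩ cell S).Nonempty → GradVanishesOn (cell S') v) :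
    GradVanishesOn (cell S) (I v : energySpace Γ) :=
  hI.gradVanishesOn hK hS <| GradVanishesOn.biUnion
    (hK.finite_facets.subset fun _ h => h.1) fun S' hS' => h S' hS'.1 hS'.2

end Interpolation

/-! ### Products with layer cutoff functions -/

section Product

variable {η : Plane → ℝ} {D : Plane → Plane} {Dτ : Fin Γ.n → ℝ → ℝ} {L : ℝ} {W S : Set Plane}
  {v w : energySpace Γ}

theorem IsCutoffProduct.gradVanishesOn (h : IsCutoffProduct η D Dτ L W v w)
    (hη : ∀ x ∈ S, η x = 0) (hD : ∀ᵐ x ∂volume.restrict Ω, x ∈ S → D x = 0)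
    (hDτ : ∀ i, ∀ᵐ t ∂volume.restrict (Icc 0 (Γ.len i)), Γ.curve i t ∈ S → Dτ i t = 0) :
    GradVanishesOn S w := by
  refine ⟨?_, fun i => ?_⟩
  · filter_upwards [h.grad_eq, hD] with x h1 h2 hx
    rw [h1, h2 hx, hη x hx, zero_smul, smul_zero, add_zero]
  · filter_upwards [h.tgrad_eq i, hDτ i] with t h1 h2 ht
    rw [h1, h2 ht, hη _ ht, zero_mul, zero_mul, add_zero]

theorem IsCutoffProduct.gradVanishesOn_sub (h : IsCutoffProduct η D Dτ L W v w)
    (hη : ∀ x ∈ S, η x = 1) (hD : ∀ᵐ x ∂volume.restrict Ω, x ∈ S → D x = 0)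
    (hDτ : ∀ i, ∀ᵐ t ∂volume.restrict (Icc 0 (Γ.len i)), Γ.curve i t ∈ S → Dτ i t = 0) :
    GradVanishesOn S (w - v) := by
  refine ⟨?_, fun i => ?_⟩
  · filter_upwards [h.grad_eq, hD, grad_sub w v] with x h1 h2 h3 hx
    rw [h3, h1, h2 hx, hη x hx, one_smul, smul_zero, add_zero, sub_self]
  · filter_upwards [h.tgrad_eq i, hDτ i, tgrad_sub w v i] with t h1 h2 h3 ht
    rw [h3, h1, h2 ht, hη _ ht, one_mul, zero_mul, add_zero, sub_self]

end Product

/-- For every `v` in `V` there is a product `w = η v`, where `η` increases from `0` on the `m`-layer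
patch to `1` outside the `m + 1`-layer patch. -/
theorem MeshRegular.exists_cutoffProduct (hΩ : IsOpen Ω) (hK : IsTriangulation K Ω)
    (hM : MeshRegular K H γ) {T : Finset Plane} (hT : T ∈ K.facets) (m : ℕ) (v : energySpace Γ) :
    ∃ (η : Plane → ℝ) (D : Plane → Plane) (Dτ : Fin Γ.n → ℝ → ℝ) (w : energySpace Γ),
      IsCutoffProduct η D Dτ (2 * γ / H) (annulus K T m (m + 1)) v w ∧
      (∀ x ∈ outer K T (m + 1), η x = 1) ∧
      (∀ S ∈ layer K T m, GradVanishesOn (cell S) w) ∧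
      ∀ S ∈ K.facets, S ∉ layer K T (m + 1) → GradVanishesOn (cell S) (w - v) := by
  classical
  have hH := hM.1
  have hγ := (hM.exists_closedBall_subset hK hT).1
  have hL : 0 ≤ 2 * γ / H := by positivity
  obtain ⟨η, hη, hηc⟩ := hM.exists_cutoff hK (fun z => if z ∈ patch K m T then 0 else 1)
    (fun z => by split_ifs <;> simp)
  have h0 : ∀ S ∈ layer K T m, ∀ x ∈ cell S, η x = 0 := fun S hS =>
    hηc S (layer_subset_facets hT m hS) 0 fun z hz =>
      if_pos (cell_subset_patch hS (subset_cell S hz))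
  have h1 : ∀ S ∈ K.facets, S ∉ layer K T (m + 1) → ∀ x ∈ cell S, η x = 1 := fun S hS hSm =>
    hηc S hS 1 fun z hz => if_neg fun hzp => hSm ⟨hS, z, subset_cell S hz, hzp⟩
  have hgrad : ∀ S ∈ K.facets, ∀ c, (∀ x ∈ cell S, η x = c) →
      ∀ᵐ x ∂volume.restrict Ω, x ∈ cell S → gradient η x = 0 := by
    intro S hS c hc
    filter_upwards [hK.ae_mem_interior_cell] with x hx hxS
    exact gradient_eq_zero_of_eq_const hc (hx S hS hxS)
  have hderiv : ∀ S : Finset Plane, ∀ c, (∀ x ∈ cell S, η x = c) → ∀ i,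
      ∀ᵐ t ∂volume.restrict (Icc 0 (Γ.len i)),
        Γ.curve i t ∈ cell S → deriv (η ∘ Γ.curve i) t = 0 := by
    intro S c hc i
    filter_upwards [ae_restrict_of_ae (ae_deriv_eq_zero_of_eq_const (η ∘ Γ.curve i) c)]
      with t ht htS using ht (hc _ htS)
  have hconst : ∀ S ∈ K.facets, S ∉ layer K T (m + 1) \ layer K T m →
      ∃ c, ∀ x ∈ cell S, η x = c := by
    intro S hS hSm
    by_cases hSm1 : S ∈ layer K T (m + 1)
    · exact ⟨0, h0 S (by by_contra h; exact hSm ⟨hSm1, h⟩)⟩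
    · exact ⟨1, h1 S hS hSm1⟩
  obtain ⟨w, hw, hwτ⟩ := hη.exists_mul hΩ hK hL v
  have hprod : IsCutoffProduct η (gradient η) (fun i => deriv (η ∘ Γ.curve i)) (2 * γ / H)
      (annulus K T m (m + 1)) v w := by
    refine ⟨hη.mem_Icc, ?_, fun i => ?_, hw, hwτ⟩
    · have hall : ∀ᵐ x ∂volume.restrict Ω, ∀ S ∈ K.facets,
          S ∉ layer K T (m + 1) \ layer K T m → x ∈ cell S → gradient η x = 0 :=
        (ae_ball_iff hK.finite_facets.countable).2 fun S hS => by
          by_cases hSm : S ∈ layer K T (m + 1) \ layer K T m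
          · exact Eventually.of_forall fun x h => absurd hSm h
          · obtain ⟨c, hc⟩ := hconst S hS hSm
            exact (hgrad S hS c hc).mono fun x hx _ => hx
      filter_upwards [hη.ae_norm_gradient_le hK hL, hall, ae_restrict_mem hΩ.measurableSet]
        with x hx hx0 hxΩ
      refine ⟨hx hxΩ, fun hxW => ?_⟩
      obtain ⟨S, hS, hxS⟩ := hK.exists_mem_cell (subset_closure hxΩ)
      exact hx0 S hS (fun h => hxW (mem_biUnion h hxS)) hxS
    · have hall : ∀ᵐ t ∂volume.restrict (Icc 0 (Γ.len i)), ∀ S ∈ K.facets,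
          S ∉ layer K T (m + 1) \ layer K T m → Γ.curve i t ∈ cell S →
            deriv (η ∘ Γ.curve i) t = 0 :=
        (ae_ball_iff hK.finite_facets.countable).2 fun S hS => by
          by_cases hSm : S ∈ layer K T (m + 1) \ layer K T m
          · exact Eventually.of_forall fun x h => absurd hSm h
          · obtain ⟨c, hc⟩ := hconst S hS hSm
            exact (hderiv S c hc i).mono fun x hx _ => hx
      filter_upwards [hη.ae_abs_deriv_le Γ hK hL i, hall, ae_restrict_mem measurableSet_Icc]
        with t ht ht0 htI
      refine ⟨ht, fun htW => ?_⟩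
      obtain ⟨S, hS, htS⟩ := hK.exists_mem_cell (Γ.curve_mem_closure i htI)
      exact ht0 S hS (fun h => htW (mem_biUnion h htS)) htS
  refine ⟨η, gradient η, fun i => deriv (η ∘ Γ.curve i), w, hprod, fun x hx => ?_, fun S hS => ?_,
    fun S hS hSm => ?_⟩
  · obtain ⟨S, hS, hxS⟩ := mem_iUnion₂.1 hx
    exact h1 S hS.1 hS.2 x hxS
  · exact hprod.gradVanishesOn (h0 S hS)
      (hgrad S (layer_subset_facets hT m hS) 0 (h0 S hS)) (hderiv S 0 (h0 S hS))
  · exact hprod.gradVanishesOn_sub (h1 S hS hSm)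
      (hgrad S hS 1 (h1 S hS hSm)) (hderiv S 1 (h1 S hS hSm))

/-! ### Decay of the corrector -/

section Decay

variable {A AΓ : Plane → ℝ} {α β : ℝ} {I : energySpace Γ →ₗ[ℝ] coarseSpace Γ K}
  {T : Finset Plane} {v : coarseSpace Γ K} {φ : energySpace Γ}

/-- The energy of the corrector is bounded by the energy of its data. -/
theorem IsCorrector.energyMeasure_univ_le (hφ : IsCorrector A AΓ I T v φ) (hΩ : IsOpen Ω)
    (hα : 0 < α) (hαβ : α ≤ β) (hA : CoefficientBounds Γ A AΓ α β) :
    (energyMeasure φ).real univ ≤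
      (β / α) ^ 2 * (energyMeasure (v : energySpace Γ)).real (cell T) := by
  -- `φ` is its own product with the cutoff function `1`, which turns the lower bound for products
  -- into coercivity
  have hself : IsCutoffProduct (fun _ => 1) (fun _ => 0) (fun _ _ => 0) 0 ∅ φ φ :=
    ⟨fun _ => by simp, by simp, by simp, by simp, by simp⟩
  have h1 := hself.le_form hΩ hα.le hA isClosed_univ isClosed_empty (fun _ _ _ => rfl)
  rw [hφ.2 φ hφ.1] at h1
  have hβ := hα.trans_le hαβ
  have h2 := abs_form_le (v := (v : energySpace Γ)) (w := φ) (S := cell T) (R := univ) hα.le hA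
    (isClosed_cell T) isClosed_univ (by simp [GradVanishesOn]) (s := β / α) (by positivity)
  have h3 : (energyMeasure φ).real (cell T) ≤ (energyMeasure φ).real univ :=
    measureReal_mono (subset_univ _)
  rw [inter_univ] at h2
  simp only [measureReal_empty, mul_zero, add_zero] at h1
  have h4 := h1.trans ((le_abs_self _).trans h2)
  set e := (energyMeasure φ).real univ
  set g := (energyMeasure (v : energySpace Γ)).real (cell T)
  have h5 : β / 2 * (β / α * g + (β / α)⁻¹ * (energyMeasure φ).real (cell T)) ≤
      β / 2 * (β / α * g + (β / α)⁻¹ * e) := by gcongr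
  have h6 : β / 2 * (β / α * g + (β / α)⁻¹ * e) = α / 2 * ((β / α) ^ 2 * g) + α / 2 * e := by
    field_simp
  have h7 : α / 2 * e ≤ α / 2 * ((β / α) ^ 2 * g) := by linarith
  exact le_of_mul_le_mul_left h7 (by positivity)

/-- The constant in the Caccioppoli inequality. -/
noncomputable def caccioppoliConst (β γ C : ℝ) : ℝ :=
  β / 2 * (512 * γ ^ 4 * C ^ 2 + 1) +
    β / 2 * (1 + 128 * C ^ 2 * γ ^ 2 * (2 + 2 * (512 * γ ^ 4 * C ^ 2)))

/-- Testing the equation of the corrector with `ψ - I ψ`. -/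
theorem IsCorrector.form_eq_form_interpolation (hφ : IsCorrector A AΓ I T v φ) (hα : 0 ≤ α)
    (hA : CoefficientBounds Γ A AΓ α β)
    (hII : ∀ v : energySpace Γ, I (I v : energySpace Γ) = I v) {ψ : energySpace Γ}
    (hψ : GradVanishesOn (cell T) ψ) (hIψ : GradVanishesOn (cell T) (I ψ : energySpace Γ)) :
    form A AΓ univ φ ψ = form A AΓ univ φ (I ψ : energySpace Γ) := by
  have h := hφ.2 _ (sub_mem_fineSpace (hII ψ).symm)
  have h1 := form_sub_right (S := univ) hα hA φ ψ (I ψ : energySpace Γ)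
  have h2 := form_sub_right (S := cell T) hα hA (v : energySpace Γ) ψ (I ψ : energySpace Γ)
  have h3 := form_eq_zero (v := (v : energySpace Γ)) hα hA (isClosed_cell T) hψ
  have h4 := form_eq_zero (v := (v : energySpace Γ)) hα hA (isClosed_cell T) hIψ
  exact sub_eq_zero.1 <| h1.symm.trans <| h.trans <| h2.trans <|
    (congrArg₂ (· - ·) h3 h4).trans (sub_zero 0)

/-- How the bounds combine in the Caccioppoli inequality. Here `e` is the energy outside, `f` the
tested form, `r` the energy in the large annulus, `w` and `m` the energy and the scaled mass where
the cutoff function varies, `s` the energy of the product, `q` and `q'` the energies of the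
corrector and of the interpolated product in the annulus where the latter lives. -/
theorem le_caccioppoliConst_mul {e f f' m w q q' s r : ℝ} (hβ : 0 < β)
    (hlower : α * e ≤ f + β / 2 * (m + w)) (hf : f = f')
    (hupper : |f'| ≤ β / 2 * (1 * q + 1⁻¹ * q')) (hm : m ≤ 512 * γ ^ 4 * C ^ 2 * r) (hw : w ≤ r)
    (hq : q ≤ r) (hq' : q' ≤ 128 * C ^ 2 * γ ^ 2 * s)
    (hs : s ≤ (2 + 2 * (512 * γ ^ 4 * C ^ 2)) * r) : α * e ≤ caccioppoliConst β γ C * r := by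
  have h1 : q' ≤ 128 * C ^ 2 * γ ^ 2 * ((2 + 2 * (512 * γ ^ 4 * C ^ 2)) * r) :=
    hq'.trans (mul_le_mul_of_nonneg_left hs (by positivity))
  calc α * e ≤ f + β / 2 * (m + w) := hlower
    _ ≤ β / 2 * (1 * q + 1⁻¹ * q') + β / 2 * (m + w) := by
        gcongr
        exact hf.trans_le ((le_abs_self _).trans hupper)
    _ ≤ β / 2 * (1 * r + 1⁻¹ * (128 * C ^ 2 * γ ^ 2 * ((2 + 2 * (512 * γ ^ 4 * C ^ 2)) * r))) +
          β / 2 * (512 * γ ^ 4 * C ^ 2 * r + r) := by gcongr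
    _ = caccioppoliConst β γ C * r := by rw [caccioppoliConst]; ring

set_option maxHeartbeats 1000000 in
/-- A Caccioppoli inequality: the energy of the corrector away from `T` is bounded by its energy in
an annulus. The test function is `ψ - I ψ`, where `ψ` is the product of the corrector and a cutoff
function; the right-hand side does not see it, since its gradient vanishes on `T`. -/
theorem IsCorrector.energyMeasure_outer_le (hφ : IsCorrector A AΓ I T v φ) (hΩ : IsOpen Ω)
    (hK : IsTriangulation K Ω) (hM : MeshRegular K H γ) (hα : 0 < α) (hαβ : α ≤ β)
    (hA : CoefficientBounds Γ A AΓ α β) (hI : InterpolationBounds K H C I)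
    (hII : ∀ v : energySpace Γ, I (I v : energySpace Γ) = I v) (hT : T ∈ K.facets) (j : ℕ) :
    α * (energyMeasure φ).real (outer K T (j + 3)) ≤
      caccioppoliConst β γ C * (energyMeasure φ).real (annulus K T j (j + 5)) := by
  have hβ := hα.trans_le hαβ
  have hH := hM.1
  obtain ⟨η, D, Dτ, ψ, hprod, hη1, hψ0, hψ1⟩ :=
    hM.exists_cutoffProduct hΩ hK hT (j + 2) φ
  set W := annulus K T (j + 2) (j + 2 + 1) with hWdef
  set Q := annulus K T (j + 1) (j + 4) with hQdef
  set R := annulus K T j (j + 5) with hRdef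
  have hWc : IsClosed W := hK.isClosed_annulus hT _ _
  have hQc : IsClosed Q := hK.isClosed_annulus hT _ _
  have hRc : IsClosed R := hK.isClosed_annulus hT _ _
  have hWR : W ⊆ R := annulus_mono hT (by omega) (by omega)
  have hQR : Q ⊆ R := annulus_mono hT (by omega) (by omega)
  -- the cutoff function varies on a scale on which the Poincaré inequality applies
  have hmass : (2 * γ / H) ^ 2 * (massMeasure φ).real W ≤
      512 * γ ^ 4 * C ^ 2 * (energyMeasure φ).real R := by
    have h := hM.measureReal_biUnion_le hK (μ := massMeasure φ) (ν := energyMeasure φ)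
      (c := 2 * C ^ 2 * H ^ 2) (by positivity)
      (F := layer K T (j + 2 + 1) \ layer K T (j + 2)) (R := R)
      (fun S hS => layer_subset_facets hT _ hS.1)
      (fun S hS => hI.massMeasure_le hK hφ.1 (layer_subset_facets hT _ hS.1)) hRc
      (fun S hS => (nbhd_subset_annulus hT hS).trans (annulus_mono hT (by omega) (by omega)))
    calc (2 * γ / H) ^ 2 * (massMeasure φ).real W
        ≤ (2 * γ / H) ^ 2 * (2 * C ^ 2 * H ^ 2 * (64 * γ ^ 2) * (energyMeasure φ).real R) :=
          mul_le_mul_of_nonneg_left h (by positivity)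
      _ = _ := by field_simp; ring
  have hψR : (energyMeasure ψ).real R ≤
      (2 + 2 * (512 * γ ^ 4 * C ^ 2)) * (energyMeasure φ).real R := by
    have h := hprod.energyMeasure_le hRc hWc
    rw [inter_eq_right.2 hWR] at h
    linarith
  -- the interpolant of `ψ` lives in the annulus `Q`
  have hIψ : ∀ S ∈ K.facets, S ∉ layer K T (j + 4) \ layer K T (j + 1) →
      GradVanishesOn (cell S) (I ψ : energySpace Γ) := by
    intro S hS hSQ
    by_cases hSj : S ∈ layer K T (j + 1)
    · refine hI.gradVanishesOn_of_nbhd hK hS fun S' hS' hne => ?_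
      exact hψ0 S' (mem_layer_succ_of_inter hS' hSj hne)
    · -- here `ψ = φ`, whose interpolant vanishes
      rw [← interpolation_sub_eq hφ.1 ψ]
      refine hI.gradVanishesOn_of_nbhd hK hS fun S' hS' hne => ?_
      refine hψ1 S' hS' fun h => hSQ ⟨?_, hSj⟩
      exact mem_layer_succ_of_inter hS h (by rwa [inter_comm])
  have hIQ : (energyMeasure (I ψ : energySpace Γ)).real Q ≤
      128 * C ^ 2 * γ ^ 2 * (energyMeasure ψ).real R := by
    have h := hM.measureReal_biUnion_le hK (μ := energyMeasure (I ψ : energySpace Γ))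
      (ν := energyMeasure ψ) (c := 2 * C ^ 2) (by positivity)
      (F := layer K T (j + 4) \ layer K T (j + 1)) (R := R)
      (fun S hS => layer_subset_facets hT _ hS.1)
      (fun S hS => hI.energyMeasure_le hK ψ (layer_subset_facets hT _ hS.1)) hRc
      (fun S hS => nbhd_subset_annulus hT hS)
    calc _ ≤ _ := h
      _ = _ := by ring
  have hT0 : T ∈ layer K T (j + 1) := layer_mono hT (Nat.zero_le _) (by simp [layer])
  have htest := hφ.form_eq_form_interpolation hα.le hA hII
    (hψ0 T (layer_mono hT (Nat.le_succ _) hT0)) (hIψ T hT fun h => h.2 hT0)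
  have hlower := hprod.le_form hΩ hα.le hA (hK.isClosed_outer (T := T) (j + 2 + 1)) hWc
    fun x _ hx => hη1 x hx
  have hupper := abs_form_le (v := φ) (w := (I ψ : energySpace Γ)) hα.le hA isClosed_univ hQc
    (GradVanishesOn.compl_biUnion hΩ hK hIψ) one_pos
  simp only [univ_inter] at hupper
  exact le_caccioppoliConst_mul hβ hlower htest hupper hmass (measureReal_mono hWR)
    (measureReal_mono hQR) hIQ hψR

/-- Six further layers reduce the energy of the corrector by a constant factor: hole filling. -/
theorem IsCorrector.energyMeasure_outer_add_six_le (hφ : IsCorrector A AΓ I T v φ) (hΩ : IsOpen Ω)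
    (hK : IsTriangulation K Ω) (hM : MeshRegular K H γ) (hα : 0 < α) (hαβ : α ≤ β)
    (hA : CoefficientBounds Γ A AΓ α β) (hI : InterpolationBounds K H C I)
    (hII : ∀ v : energySpace Γ, I (I v : energySpace Γ) = I v) (hT : T ∈ K.facets) (j : ℕ) :
    (energyMeasure φ).real (outer K T (j + 6)) ≤
      caccioppoliConst β γ C / (α + caccioppoliConst β γ C) *
        (energyMeasure φ).real (outer K T j) := by
  have hβ := hα.trans_le hαβ
  have hc : 0 < caccioppoliConst β γ C := by rw [caccioppoliConst]; positivity
  have h1 := hφ.energyMeasure_outer_le hΩ hK hM hα hαβ hA hI hII hT j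
  have h2 : (energyMeasure φ).real (outer K T (j + 6)) ≤
      (energyMeasure φ).real (outer K T (j + 3)) := measureReal_mono (outer_anti hT (by omega))
  have h3 : (energyMeasure φ).real (annulus K T j (j + 5)) +
      (energyMeasure φ).real (outer K T (j + 6)) ≤ (energyMeasure φ).real (outer K T j) := by
    rw [← measureReal_union (disjoint_annulus_outer j (j + 5))
      (hK.isClosed_outer _).measurableSet]
    exact measureReal_mono (union_subset (annulus_subset_outer hT _ _) (outer_anti hT (by omega)))
  rw [div_mul_eq_mul_div, le_div_iff₀ (by positivity)]
  have h4 := mul_le_mul_of_nonneg_left h2 hα.le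
  have h5 := mul_le_mul_of_nonneg_left h3 hc.le
  linarith

end Decay

/-- A nonincreasing sequence that loses a factor `θ` every six steps decays geometrically. -/
theorem le_pow_div_six_mul {E : ℕ → ℝ} {θ : ℝ} (hθ : 0 ≤ θ) (hE : Antitone E)
    (h : ∀ j, E (j + 6) ≤ θ * E j) (k : ℕ) : E k ≤ θ ^ (k / 6) * E 0 := by
  have key : ∀ q, E (6 * q) ≤ θ ^ q * E 0 := by
    intro q
    induction q with
    | zero => simp
    | succ q ih =>
      calc E (6 * (q + 1)) ≤ θ * E (6 * q) := h (6 * q)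
        _ ≤ θ * (θ ^ q * E 0) := mul_le_mul_of_nonneg_left ih hθ
        _ = θ ^ (q + 1) * E 0 := by ring
  exact (hE (Nat.mul_div_le k 6)).trans (key _)

/-- Converts a decay by the factor `exp (-12 c)` every six steps into exponential decay. -/
theorem exp_pow_div_six_le {c : ℝ} (hc : 0 ≤ c) (k : ℕ) :
    Real.exp (-(12 * c)) ^ (k / 6) ≤ (Real.exp (6 * c) * Real.exp (-(c * k))) ^ 2 := by
  rw [← Real.exp_nat_mul, ← Real.exp_add, ← Real.exp_nat_mul, Real.exp_le_exp]
  have h : (k : ℝ) ≤ 6 * ((k / 6 : ℕ) : ℝ) + 6 := by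
    have : k ≤ 6 * (k / 6) + 6 := by omega
    exact_mod_cast this
  have := mul_le_mul_of_nonneg_left h hc
  push_cast
  linarith

end FracturedLOD

set_option maxHeartbeats 1000000 in
open FracturedLOD in
theorem theorem1 (α β γ CI : ℝ) (hα : 0 < α) (hαβ : α ≤ β) :
    ∃ C c : ℝ, 0 < C ∧ 0 < c ∧
      ∀ (Ω : Set FracturedLOD.Plane) (Γ : FracturedLOD.Interface Ω)
        (K : Geometry.SimplicialComplex ℝ FracturedLOD.Plane) (H : ℝ)
        (A AΓ : FracturedLOD.Plane → ℝ)
        (I : FracturedLOD.energySpace Γ →ₗ[ℝ] FracturedLOD.coarseSpace Γ K),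
        FracturedLOD.IsPolygonalDomain Ω →
        FracturedLOD.IsTriangulation K Ω →
        FracturedLOD.MeshRegular K H γ →
        FracturedLOD.CoefficientBounds Γ A AΓ α β →
        FracturedLOD.InterpolationBounds K H CI I →
        (∀ v : FracturedLOD.energySpace Γ, I (I v : FracturedLOD.energySpace Γ) = I v) →
        ∀ T ∈ K.facets, ∀ (v : FracturedLOD.coarseSpace Γ K) (φ : FracturedLOD.energySpace Γ),
          FracturedLOD.IsCorrector A AΓ I T v φ →
          ∀ k : ℕ, 5 ≤ k →
            FracturedLOD.gradNorm (FracturedLOD.patchCompl Ω K k T) φ ≤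
              C * Real.exp (-(c * k)) *
                FracturedLOD.gradNorm (FracturedLOD.cell T)
                  (v : FracturedLOD.energySpace Γ) := by
  have hβ := hα.trans_le hαβ
  have hQ : 0 < caccioppoliConst β γ CI := by rw [caccioppoliConst]; positivity
  set θ := caccioppoliConst β γ CI / (α + caccioppoliConst β γ CI) with hθdef
  have hθ0 : 0 < θ := by positivity
  have hθ1 : θ < 1 := by rw [hθdef, div_lt_one (by positivity)]; linarith
  obtain ⟨c, hc⟩ : ∃ c, c = -Real.log θ / 12 := ⟨_, rfl⟩
  have hc0 : 0 < c := by rw [hc]; linarith [Real.log_neg hθ0 hθ1]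
  have hθc : θ = Real.exp (-(12 * c)) := by
    rw [hc, show -(12 * (-Real.log θ / 12)) = Real.log θ by ring, Real.exp_log hθ0]
  refine ⟨2 * (β / α) * Real.exp (6 * c), c, by positivity, hc0, ?_⟩
  intro Ω Γ K H A AΓ I hpoly hK hM hA hI hII T hT v φ hφ k _
  have hΩ : IsOpen Ω := by
    obtain ⟨-, F, -, -, rfl⟩ := hpoly
    exact isOpen_interior
  have hdecay := le_pow_div_six_mul (E := fun j => (energyMeasure φ).real (outer K T j)) hθ0.le
    (fun i j hij => measureReal_mono (outer_anti hT hij))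
    (fun j => hφ.energyMeasure_outer_add_six_le hΩ hK hM hα hαβ hA hI hII hT j) k
  have h0 : (energyMeasure φ).real (outer K T 0) ≤
      (β / α) ^ 2 * gradNorm (cell T) (v : energySpace Γ) ^ 2 :=
    (measureReal_mono (subset_univ _)).trans <|
      (hφ.energyMeasure_univ_le hΩ hα hαβ hA).trans <|
        mul_le_mul_of_nonneg_left (energyMeasure_real_le_sq (isClosed_cell T)) (by positivity)
  have hg := gradNorm_nonneg (cell T) (v : energySpace Γ)
  refine le_of_sq_le_sq ?_ (by positivity)
  calc gradNorm (patchCompl Ω K k T) φ ^ 2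
      ≤ 2 * (energyMeasure φ).real (patchCompl Ω K k T) := gradNorm_sq_le isClosed_closure
    _ ≤ 2 * (energyMeasure φ).real (outer K T k) := by
        gcongr
        · exact measure_ne_top _ _
        · exact hK.patchCompl_subset_outer k
    _ ≤ 2 * (θ ^ (k / 6) * ((β / α) ^ 2 * gradNorm (cell T) (v : energySpace Γ) ^ 2)) := by
        gcongr
        exact hdecay.trans (mul_le_mul_of_nonneg_left h0 (by positivity))
    _ ≤ 2 * ((Real.exp (6 * c) * Real.exp (-(c * k))) ^ 2 *
          ((β / α) ^ 2 * gradNorm (cell T) (v : energySpace Γ) ^ 2)) := by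
        gcongr
        rw [hθc]
        exact exp_pow_div_six_le hc0.le k
    _ ≤ 4 * ((Real.exp (6 * c) * Real.exp (-(c * k))) ^ 2 *
          ((β / α) ^ 2 * gradNorm (cell T) (v : energySpace Γ) ^ 2)) := by
        gcongr
        norm_num
    _ = (2 * (β / α) * Real.exp (6 * c) * Real.exp (-(c * k)) *
          gradNorm (cell T) (v : energySpace Γ)) ^ 2 := by ring
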